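/- Setting. Let $n\ge 1$ battlefields have values $w_1,\dots,w_n>0$ with $\sum_b w_b=1$. For $P,R_A\ge 0$ and $R_B>0$ consider the following two-stage game. In Stage 1 player $A$ chooses $\boldsymbol p\in\Delta_n(P)=\{\boldsymbol p\in\mathbb R_+^n:\sum_b p_b=P\}$, which player $B$ observes. In Stage 2 the players $i\in\{A,B\}$ simultaneously choose probability distributions $F_i\in\mathcal L(R_i)$, i.e. distributions on $\mathbb R_+^n$ with $\mathbb E_{\boldsymbol x_i\sim F_i}[\sum_b x_{i,b}]\le R_i$. With $\boldsymbol x_A\sim F_A$ and $\boldsymbol x_B\sim F_B$ independent, player $A$ wins battlefield $b$ if $x_{A,b}+p_b>x_{B,b}$ and loses it if $x_{A,b}+p_b<x_{B,b}$; a tie is won by $A$ with probability $\tau_b$, where $\tau\in[0,1]^n$ is an arbitrary fixed tie-breaking rule. The payoff $U_A(\boldsymbol p,F_A,F_B)$ is the expected total value of the battlefields won by $A$, and $U_B=1-U_A$. A subgame-perfect equilibrium (SPE) consists of $\boldsymbol p^*\in\Delta_n(P)$ and, for every $\boldsymbol p\in\Delta_n(P)$, a Nash equilibrium $(F_A^*(\boldsymbol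 p),F_B^*(\boldsymbol p))$ of the Stage 2 game, such that $\boldsymbol p^*$ maximizes $\boldsymbol p\mapsto U_A(\boldsymbol p,F_A^*(\boldsymbol p),F_B^*(\boldsymbol p))$ over $\Delta_n(P)$. Write $\pi_A^*(P,R_A,R_B)$ for player $A$'s payoff in an SPE. Investment problem. Let player $A$ have a monetary budget $M_A>0$, with unit cost $c_A>0$ for pre-allocated resources and unit cost $1$ for real-time resources, and let $R_B>0$. Put $$\mathcal I(M_A)=\{(P,R_A)\in\mathbb R_+^2: R_A+c_AP\le M_A\},\qquad \pi_A^{\mathrm{opt}}=\max_{(P,R_A)\in\mathcal I(M_A)}\pi_A^*(P,R_A,R_B),$$ where the maximum is over those feasible $(P,R_A)$ for which an SPE exists. Theorem. For all $P,R_A\ge 0$, all SPEs give player $A$ the same payoff, so that $\pi_A^*(P,R_A,R_B)$ is unique whenever an SPE exists; an SPE exists whenever $R_A>0$, and also when $R_A=0$ if all ties are won by $B$ ($\tau=0$). Let $t:=\min\{1,M_A/R_B\}$. The maximum $\pi_A^{\mathrm{opt}}$ is attained, and $(P^*,R_A^*)$ is a maximizer if and only if $R_A^*=M_A-c_AP^*$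 and $$P^*\ \begin{cases}=\dfrac{2(1-c_A)}{2-c_A}\dfrac{M_A}{c_A}, & \text{if } c_A<t,\\[2mm] \in\Big[0,\dfrac{2(1-c_A)}{2-c_A}\dfrac{M_A}{c_A}\Big], & \text{if } c_A=t,\\[2mm] =0, & \text{if } c_A>t.\end{cases}$$ The optimal payoff is $$\pi_A^{\mathrm{opt}}=\begin{cases}1-\dfrac{R_B}{2M_A}c_A(2-c_A), & \text{if } c_A<t,\\[2mm] 1-\dfrac{R_B}{2M_A}, & \text{if } c_A\ge t\text{ and } M_A/R_B\ge 1,\\[2mm] \dfrac{M_A}{2R_B}, & \text{if } c_A\ge t\text{ and } M_A/R_B<1.\end{cases}$$ -/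

import Mathlib

open MeasureTheory
open scoped ENNReal NNReal

noncomputable section

namespace GeneralLotto

/-- The probability that player A wins a battlefield on which it has committed `a` resources in
total (pre-allocated plus real-time) and player B has committed `b`. A tie is won by player A with
probability `θ`. -/
def winProb (θ a b : ℝ) : ℝ :=
  if b < a then 1 else if a = b then θ else 0

/-- The set `Δ_n(P)` of pre-allocation profiles with total budget `P`. -/
def preallocations (n : ℕ) (P : ℝ) : Set (Fin n → ℝ) :=
  {p | (∀ b, 0 ≤ p b) ∧ ∑ b, p b = P}

/-- The set `L(R)` of real-time strategies: the laws of random allocations in `ℝ₊ⁿ` whose expected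
total expenditure does not exceed `R`. -/
def lottoStrategies (n : ℕ) (R : ℝ) : Set (Measure (Fin n → ℝ≥0)) :=
  {F | IsProbabilityMeasure F ∧ ∫⁻ x, ∑ b, (x b : ℝ≥0∞) ∂F ≤ ENNReal.ofReal R}

variable {n : ℕ}

/-- Expected payoff `U_A(p, F_A, F_B)` of player A; `w` are the battlefield values and `τ b` is the
probability that a tie on battlefield `b` is won by player A. The two players randomize
independently. -/
def payoffA (w τ p : Fin n → ℝ) (FA FB : Measure (Fin n → ℝ≥0)) : ℝ :=
  ∫ x, ∑ b, w b * winProb (τ b) ((x.1 b : ℝ) + p b) (x.2 b : ℝ) ∂(FA.prod FB)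

/-- Expected payoff `U_B = 1 - U_A` of player B (the total battlefield value is `1`). -/
def payoffB (w τ p : Fin n → ℝ) (FA FB : Measure (Fin n → ℝ≥0)) : ℝ :=
  1 - payoffA w τ p FA FB

/-- `(FA, FB)` is a Nash equilibrium of the simultaneous-move game that is played in the second
stage, given the pre-allocation profile `p`. -/
structure IsStageTwoNash (w τ p : Fin n → ℝ) (RA RB : ℝ)
    (FA FB : Measure (Fin n → ℝ≥0)) : Prop where
  memA : FA ∈ lottoStrategies n RA
  memB : FB ∈ lottoStrategies n RB
  bestA : ∀ GA ∈ lottoStrategies n RA, payoffA w τ p GA FB ≤ payoffA w τ p FA FB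
  bestB : ∀ GB ∈ lottoStrategies n RB, payoffB w τ p FA GB ≤ payoffB w τ p FA FB

/-- Subgame-perfect equilibrium of the two-stage game with budgets `P`, `RA`, `RB`: the second-stage
strategies `FA p`, `FB p` form a Nash equilibrium after every pre-allocation profile `p`, and
`pStar` is an optimal profile given these continuations. Only the values of `FA` and `FB` on
`preallocations n P` matter. -/
structure IsSPE (w τ : Fin n → ℝ) (P RA RB : ℝ) (pStar : Fin n → ℝ)
    (FA FB : (Fin n → ℝ) → Measure (Fin n → ℝ≥0)) : Prop where
  mem : pStar ∈ preallocations n P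
  nash : ∀ p ∈ preallocations n P, IsStageTwoNash w τ p RA RB (FA p) (FB p)
  optimal : ∀ p ∈ preallocations n P,
    payoffA w τ p (FA p) (FB p) ≤ payoffA w τ pStar (FA pStar) (FB pStar)

/-- `v` is the payoff `π_A^*(P, RA, RB)` of player A in some subgame-perfect equilibrium. -/
def IsSPEPayoff (w τ : Fin n → ℝ) (P RA RB v : ℝ) : Prop :=
  ∃ pStar FA FB, IsSPE w τ P RA RB pStar FA FB ∧ v = payoffA w τ pStar (FA pStar) (FB pStar)

/-- The set `I(M)` of investments `(P, RA) ∈ ℝ₊²` that player A can afford with monetary budget `M`,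
when pre-allocated resources cost `c` per unit and real-time resources cost `1` per unit. -/
def feasibleInvestments (M c : ℝ) : Set (ℝ × ℝ) :=
  {x | 0 ≤ x.1 ∧ 0 ≤ x.2 ∧ x.2 + c * x.1 ≤ M}

/-- `(P, RA)` maximizes player A's subgame-perfect equilibrium payoff among all feasible
investments, and the maximal payoff is `v`. -/
def IsOptimalInvestment (w τ : Fin n → ℝ) (M c RB P RA v : ℝ) : Prop :=
  (P, RA) ∈ feasibleInvestments M c ∧ IsSPEPayoff w τ P RA RB v ∧
    ∀ y ∈ feasibleInvestments M c, ∀ u, IsSPEPayoff w τ y.1 y.2 RB u → u ≤ v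

end GeneralLotto

end

namespace GeneralLotto

variable {n : ℕ}

/-! The second stage is zero-sum, so Nash payoffs at a fixed `p` are interchangeable
(`IsStageTwoNash.payoffA_eq`), and equilibria may be found as saddle points. A budget binds only in
expectation, so a strategy guarantees a payoff once it bounds the opponent's winnings by an affine
function of the opponent's expenditure (`payoffA_le`, `le_payoffA`). Only marginals enter the
payoff, hence one uniform variable can drive all battlefields.

For `RA > 0`, B contests battlefield `b` with probability `μ b`, bidding uniformly just above `p b`,
and A answers with a uniform bid of the same length. The two multipliers are fixed by exhausting
both budgets (`exists_multipliers`, `exists_stageTwoNash`). Whatever `p` is, B can also contest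
everywhere with one probability `μ`, which concedes at most `1 - μ + RA / x` at cost `x * μ ^ 2 / 2
+ μ * P`. The proportional allocation has an equilibrium of exactly this form, so it is optimal.
After eliminating `x`, the equilibrium payoff is the minimum over `μ ∈ (0, 1]` with `μ * P < RB` of
`1 - μ + RA * μ ^ 2 / (2 * (RB - μ * P))` (`IsSPEPayoff.le_of_contest`, `exists_contest_of_pos`).
For `RA = 0` with ties going to B, the second stage is a fractional knapsack problem for B.

The investment problem is thus a max-min, settled by testing one `μ = m`. If `m * M ≤ c * RB`, every
affordable investment earns at most `1 - m + M * m ^ 2 / (2 * RB)` (`IsSPEPayoff.le_of_feasible`).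
With expensive pre-allocation, `m = min 1 (RB / M)` leaves only `P = 0`. Otherwise `m = c * RB / M`
makes A indifferent among all investments on the budget line with `R > 0` and `m * P < RB`, and the
optimal ones are those against which `m` is B's best choice. The excess payoff has the sign of a
quadratic in `μ` with root `m` (`le_contest_payoff_iff`); its other root must equal `m`, or merely
be at least `m` when `m = 1` is the endpoint. -/

/-! ### Pure-allocation payoffs and affine bounds. -/

theorem winProb_nonneg {θ : ℝ} (hθ : θ ∈ Set.Icc (0 : ℝ) 1) (a b : ℝ) : 0 ≤ winProb θ a b := by
  unfold winProb
  split_ifs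
  · exact zero_le_one
  · exact hθ.1
  · exact le_rfl

theorem winProb_le_one {θ : ℝ} (hθ : θ ∈ Set.Icc (0 : ℝ) 1) (a b : ℝ) : winProb θ a b ≤ 1 := by
  unfold winProb
  split_ifs
  · exact le_rfl
  · exact hθ.2
  · exact zero_le_one

theorem winProb_of_lt (θ : ℝ) {a b : ℝ} (h : a < b) : winProb θ a b = 0 := by
  unfold winProb
  rw [if_neg h.not_gt, if_neg h.ne]

theorem winProb_of_gt (θ : ℝ) {a b : ℝ} (h : b < a) : winProb θ a b = 1 := by
  unfold winProb
  rw [if_pos h]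

theorem measurable_winProb (θ : ℝ) {α : Type*} [MeasurableSpace α] {f g : α → ℝ}
    (hf : Measurable f) (hg : Measurable g) : Measurable fun x => winProb θ (f x) (g x) := by
  unfold winProb
  exact Measurable.ite (measurableSet_lt hg hf) measurable_const
    (Measurable.ite (measurableSet_eq_fun hf hg) measurable_const measurable_const)

/-- Total value won by player A when the players commit the real-time resources `x` and `y`. -/
noncomputable def wonValue (w τ p : Fin n → ℝ) (x y : Fin n → ℝ≥0) : ℝ :=
  ∑ b, w b * winProb (τ b) ((x b : ℝ) + p b) (y b : ℝ)

theorem measurable_wonValue (w τ p : Fin n → ℝ) :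
    Measurable fun z : (Fin n → ℝ≥0) × (Fin n → ℝ≥0) => wonValue w τ p z.1 z.2 := by
  unfold wonValue
  refine Finset.measurable_sum _ fun b _ => (measurable_winProb _ ?_ ?_).const_mul _
  · exact (((measurable_pi_apply b).comp measurable_fst).coe_nnreal_real).add_const _
  · exact ((measurable_pi_apply b).comp measurable_snd).coe_nnreal_real

theorem wonValue_nonneg {w τ : Fin n → ℝ} (hw : ∀ b, 0 < w b) (hτ : ∀ b, τ b ∈ Set.Icc (0 : ℝ) 1)
    (p : Fin n → ℝ) (x y : Fin n → ℝ≥0) : 0 ≤ wonValue w τ p x y :=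
  Finset.sum_nonneg fun b _ => mul_nonneg (hw b).le (winProb_nonneg (hτ b) _ _)

theorem wonValue_le_one {w τ : Fin n → ℝ} (hw : ∀ b, 0 < w b) (hw1 : ∑ b, w b = 1)
    (hτ : ∀ b, τ b ∈ Set.Icc (0 : ℝ) 1)
    (p : Fin n → ℝ) (x y : Fin n → ℝ≥0) : wonValue w τ p x y ≤ 1 := by
  rw [← hw1]
  exact Finset.sum_le_sum fun b _ =>
    mul_le_of_le_one_right (hw b).le (winProb_le_one (hτ b) _ _)

theorem norm_wonValue_le_one {w τ : Fin n → ℝ} (hw : ∀ b, 0 < w b) (hw1 : ∑ b, w b = 1)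
    (hτ : ∀ b, τ b ∈ Set.Icc (0 : ℝ) 1)
    (p : Fin n → ℝ) (x y : Fin n → ℝ≥0) :
    ‖wonValue w τ p x y‖ ≤ 1 := by
  rw [Real.norm_of_nonneg (wonValue_nonneg hw hτ p x y)]
  exact wonValue_le_one hw hw1 hτ p x y

theorem integrable_wonValue {w τ : Fin n → ℝ} (hw : ∀ b, 0 < w b) (hw1 : ∑ b, w b = 1)
    (hτ : ∀ b, τ b ∈ Set.Icc (0 : ℝ) 1)
    (p : Fin n → ℝ) (FA FB : Measure (Fin n → ℝ≥0))
    [IsProbabilityMeasure FA] [IsProbabilityMeasure FB] :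
    Integrable (fun z : (Fin n → ℝ≥0) × (Fin n → ℝ≥0) => wonValue w τ p z.1 z.2)
      (FA.prod FB) :=
  Integrable.of_bound (measurable_wonValue w τ p).aestronglyMeasurable 1
    (Filter.Eventually.of_forall fun z => norm_wonValue_le_one hw hw1 hτ p z.1 z.2)

theorem integrable_expenditure {R : ℝ} {F : Measure (Fin n → ℝ≥0)}
    (hF : F ∈ lottoStrategies n R) :
    Integrable (fun x : Fin n → ℝ≥0 => ∑ b, (x b : ℝ)) F := by
  have hm : Measurable fun x : Fin n → ℝ≥0 => ∑ b, (x b : ℝ) :=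
    Finset.measurable_sum _ fun b _ => (measurable_pi_apply b).coe_nnreal_real
  refine ⟨hm.aestronglyMeasurable, ?_⟩
  rw [hasFiniteIntegral_iff_ofReal (Filter.Eventually.of_forall fun x =>
    Finset.sum_nonneg fun b _ => (x b).coe_nonneg)]
  refine lt_of_le_of_lt ?_ (ENNReal.ofReal_lt_top (r := R))
  refine le_trans (le_of_eq ?_) hF.2
  refine lintegral_congr fun x => ?_
  rw [ENNReal.ofReal_sum_of_nonneg fun b _ => (x b).coe_nonneg]
  simp

theorem integral_expenditure_le {R : ℝ} (hR : 0 ≤ R) {F : Measure (Fin n → ℝ≥0)}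
    (hF : F ∈ lottoStrategies n R) : ∫ x, ∑ b, (x b : ℝ) ∂F ≤ R := by
  have hn : ∀ x : Fin n → ℝ≥0, 0 ≤ ∑ b, (x b : ℝ) := fun x =>
    Finset.sum_nonneg fun b _ => (x b).coe_nonneg
  rw [integral_eq_lintegral_of_nonneg_ae (Filter.Eventually.of_forall hn)
    (integrable_expenditure hF).aestronglyMeasurable]
  refine ENNReal.toReal_le_of_le_ofReal hR (le_trans (le_of_eq ?_) hF.2)
  refine lintegral_congr fun x => ?_
  rw [ENNReal.ofReal_sum_of_nonneg fun b _ => (x b).coe_nonneg]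
  simp

/-- A strategy of B that holds A's expected winnings below an affine function of A's expenditure
bounds the payoff of every strategy of A. -/
theorem payoffA_le {w τ p : Fin n → ℝ} (hw : ∀ b, 0 < w b) (hw1 : ∑ b, w b = 1)
    (hτ : ∀ b, τ b ∈ Set.Icc (0 : ℝ) 1) {R C s : ℝ} (hR : 0 ≤ R) (hs : 0 ≤ s)
    {FA FB : Measure (Fin n → ℝ≥0)} [IsProbabilityMeasure FB] (hA : FA ∈ lottoStrategies n R)
    (h : ∀ᵐ x ∂FA, ∫ y, wonValue w τ p x y ∂FB ≤ C + s * ∑ b, (x b : ℝ)) :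
    payoffA w τ p FA FB ≤ C + s * R := by
  have := hA.1
  have hi := integrable_wonValue hw hw1 hτ p FA FB
  have hE := integrable_expenditure hA
  calc payoffA w τ p FA FB = ∫ x, ∫ y, wonValue w τ p x y ∂FB ∂FA := integral_prod _ hi
    _ ≤ ∫ x, (C + s * ∑ b, (x b : ℝ)) ∂FA :=
        integral_mono_ae hi.integral_prod_left ((integrable_const C).add (hE.const_mul s)) h
    _ = C + s * ∫ x, ∑ b, (x b : ℝ) ∂FA := by
        rw [integral_add (integrable_const C) (hE.const_mul s), integral_const_mul]
        simp
    _ ≤ C + s * R := by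
        have := mul_le_mul_of_nonneg_left (integral_expenditure_le hR hA) hs
        linarith

/-- A strategy of A that keeps A's expected winnings above an affine function of B's expenditure
bounds the payoff against every strategy of B. -/
theorem le_payoffA {w τ p : Fin n → ℝ} (hw : ∀ b, 0 < w b) (hw1 : ∑ b, w b = 1)
    (hτ : ∀ b, τ b ∈ Set.Icc (0 : ℝ) 1) {R C s : ℝ} (hR : 0 ≤ R) (hs : 0 ≤ s)
    {FA FB : Measure (Fin n → ℝ≥0)} [IsProbabilityMeasure FA] (hB : FB ∈ lottoStrategies n R)
    (h : ∀ y, C - s * ∑ b, (y b : ℝ) ≤ ∫ x, wonValue w τ p x y ∂FA) :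
    C - s * R ≤ payoffA w τ p FA FB := by
  have := hB.1
  have hi := integrable_wonValue hw hw1 hτ p FA FB
  have hE := integrable_expenditure hB
  calc C - s * R ≤ C - s * ∫ x, ∑ b, (x b : ℝ) ∂FB := by
        have := mul_le_mul_of_nonneg_left (integral_expenditure_le hR hB) hs
        linarith
    _ = ∫ x, (C - s * ∑ b, (x b : ℝ)) ∂FB := by
        rw [integral_sub (integrable_const C) (hE.const_mul s), integral_const_mul]
        simp
    _ ≤ ∫ y, ∫ x, wonValue w τ p x y ∂FA ∂FB :=
        integral_mono ((integrable_const C).sub (hE.const_mul s)) hi.integral_prod_right h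
    _ = payoffA w τ p FA FB := (integral_prod_symm _ hi).symm

/-! ### Mixed bids driven by one uniform variable. -/

/-- The bid that is `0` with probability `1 - μ` and uniform on `[c, c + d μ]` otherwise, as a
function of a uniform random variable `v` on `[0, 1]`. -/
noncomputable def bid (c d μ v : ℝ) : ℝ≥0 :=
  if v < μ then (c + d * (μ - v)).toNNReal else 0

theorem measurable_bid (c d μ : ℝ) : Measurable (bid c d μ) := by
  unfold bid
  exact Measurable.ite measurableSet_Iio (by fun_prop) measurable_const

/-- The uniform distribution on `[0, 1]`. -/
noncomputable def unif : Measure ℝ := volume.restrict (Set.Icc 0 1)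

instance : IsProbabilityMeasure unif := ⟨by simp [unif]⟩

theorem le_unif_real_Iio {r : ℝ} (hr : r ≤ 1) : r ≤ unif.real (Set.Iio r) := by
  rcases le_or_gt r 0 with h | h
  · exact h.trans measureReal_nonneg
  · have hsub : Set.Ico 0 r ⊆ Set.Iio r ∩ Set.Icc 0 1 := fun x hx =>
      ⟨hx.2, hx.1, hx.2.le.trans hr⟩
    have : unif.real (Set.Iio r) = volume.real (Set.Iio r ∩ Set.Icc (0 : ℝ) 1) := by
      simp only [measureReal_def, unif]
      rw [Measure.restrict_apply measurableSet_Iio]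
    rw [this]
    calc r = volume.real (Set.Ico 0 r) := by simp [h.le]
      _ ≤ _ := measureReal_mono hsub
        (ne_top_of_le_ne_top (by simp) (measure_mono (Set.inter_subset_right)))

/-- If `f ≤ 1` vanishes below `r` then its mean is at most `1 - r`. -/
theorem integral_unif_le {f : ℝ → ℝ} {r : ℝ} (hr : r ≤ 1) (hf : Integrable f unif)
    (h1 : ∀ v, f v ≤ 1) (h0 : ∀ v < r, f v ≤ 0) : ∫ v, f v ∂unif ≤ 1 - r := by
  have hi : Integrable ((Set.Iio r).indicator fun _ => (1 : ℝ)) unif :=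
    (integrable_const 1).indicator measurableSet_Iio
  calc ∫ v, f v ∂unif ≤ ∫ v, (1 - (Set.Iio r).indicator (fun _ => (1 : ℝ)) v) ∂unif := by
        refine integral_mono hf ((integrable_const 1).sub hi) fun v => ?_
        by_cases hv : v < r
        · simpa [Set.indicator, hv] using h0 v hv
        · simpa [Set.indicator, hv] using h1 v
    _ = 1 - unif.real (Set.Iio r) := by
        rw [integral_sub (integrable_const 1) hi, integral_indicator measurableSet_Iio]
        simp
    _ ≤ 1 - r := by linarith [le_unif_real_Iio hr]

theorem integrable_bid {c d μ : ℝ} : Integrable (fun v => (bid c d μ v : ℝ)) unif := by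
  refine Integrable.of_bound (measurable_bid c d μ).coe_nnreal_real.aestronglyMeasurable
    (|c| + |d| * (|μ| + 1)) ?_
  unfold unif
  filter_upwards [ae_restrict_mem measurableSet_Icc] with v hv
  have hb : 0 ≤ |c| + |d| * (|μ| + 1) := by positivity
  unfold bid
  split_ifs with h
  · rw [Real.norm_of_nonneg (NNReal.coe_nonneg _), Real.coe_toNNReal']
    refine max_le ?_ hb
    have h1 : d * (μ - v) ≤ |d| * (|μ| + 1) := by
      refine (le_abs_self _).trans ?_
      rw [abs_mul]
      refine mul_le_mul_of_nonneg_left ?_ (abs_nonneg d)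
      refine (abs_sub μ v).trans ?_
      rw [abs_of_nonneg hv.1]
      linarith [hv.2]
    linarith [le_abs_self c]
  · simpa using hb

theorem integral_bid {c d μ : ℝ} (hc : 0 ≤ c) (hd : 0 ≤ d) (h0 : 0 ≤ μ) (h1 : μ ≤ 1) :
    ∫ v, (bid c d μ v : ℝ) ∂unif = c * μ + d * μ ^ 2 / 2 := by
  have he : ∀ v, (bid c d μ v : ℝ) = (Set.Iio μ).indicator (fun v => c + d * (μ - v)) v := by
    intro v
    unfold bid
    by_cases hv : v < μ
    · have : 0 ≤ c + d * (μ - v) := by nlinarith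
      simp [hv, this]
    · simp [hv]
  simp_rw [he]
  rw [integral_indicator measurableSet_Iio]
  unfold unif
  rw [Measure.restrict_restrict measurableSet_Iio]
  have hsub : Set.Iio μ ∩ Set.Icc 0 1 = Set.Ico 0 μ := by
    ext x
    simp only [Set.mem_inter_iff, Set.mem_Iio, Set.mem_Icc, Set.mem_Ico]
    constructor
    · rintro ⟨h1, h2, -⟩; exact ⟨h2, h1⟩
    · rintro ⟨h3, h2⟩; exact ⟨h2, h3, h2.le.trans h1⟩
  rw [hsub, integral_Ico_eq_integral_Ioc, ← intervalIntegral.integral_of_le h0]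
  have : ∀ v : ℝ, c + d * (μ - v) = (c + d * μ) - d * v := fun v => by ring
  simp_rw [this]
  rw [intervalIntegral.integral_sub (f := fun _ => c + d * μ) (g := fun v => d * v) (by simp)
    ((continuous_const.mul continuous_id).intervalIntegrable _ _),
    intervalIntegral.integral_const, intervalIntegral.integral_const_mul, integral_id]
  simp
  ring

/-- The strategy that bids `bid (c b) (d b) (μ b)` on battlefield `b`, with the same uniform
random variable for all battlefields. -/
noncomputable def bidLaw (c d μ : Fin n → ℝ) : Measure (Fin n → ℝ≥0) :=
  unif.map fun v b => bid (c b) (d b) (μ b) v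

theorem measurable_bids (c d μ : Fin n → ℝ) :
    Measurable fun (v : ℝ) b => bid (c b) (d b) (μ b) v :=
  measurable_pi_lambda _ fun b => measurable_bid (c b) (d b) (μ b)

instance (c d μ : Fin n → ℝ) : IsProbabilityMeasure (bidLaw c d μ) :=
  Measure.isProbabilityMeasure_map (measurable_bids c d μ).aemeasurable

theorem bidLaw_mem {c d μ : Fin n → ℝ} (hc : ∀ b, 0 ≤ c b) (hd : ∀ b, 0 ≤ d b)
    (h0 : ∀ b, 0 ≤ μ b) (h1 : ∀ b, μ b ≤ 1) {R : ℝ}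
    (hR : ∑ b, (c b * μ b + d b * μ b ^ 2 / 2) ≤ R) : bidLaw c d μ ∈ lottoStrategies n R := by
  refine ⟨inferInstance, ?_⟩
  have hm : Measurable fun x : Fin n → ℝ≥0 => ∑ b, (x b : ℝ≥0∞) :=
    Finset.measurable_sum _ fun b _ => (measurable_pi_apply b).coe_nnreal_ennreal
  unfold bidLaw
  rw [lintegral_map hm (measurable_bids c d μ)]
  refine le_trans (le_of_eq ?_) (ENNReal.ofReal_le_ofReal hR)
  have : ∑ b, (c b * μ b + d b * μ b ^ 2 / 2)
      = ∫ v, ∑ b, (bid (c b) (d b) (μ b) v : ℝ) ∂unif := by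
    rw [integral_finsetSum _ fun b _ => integrable_bid]
    exact Finset.sum_congr rfl fun b _ => (integral_bid (hc b) (hd b) (h0 b) (h1 b)).symm
  rw [this, ofReal_integral_eq_lintegral_ofReal (integrable_finsetSum _ fun b _ => integrable_bid)
    (Filter.Eventually.of_forall fun v => Finset.sum_nonneg fun b _ => NNReal.coe_nonneg _)]
  refine lintegral_congr fun v => ?_
  rw [ENNReal.ofReal_sum_of_nonneg fun b _ => NNReal.coe_nonneg _]
  simp

theorem integrable_winProb {θ : ℝ} (hθ : θ ∈ Set.Icc (0 : ℝ) 1) {f g : ℝ → ℝ}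
    (hf : Measurable f) (hg : Measurable g) :
    Integrable (fun v => winProb θ (f v) (g v)) unif := by
  refine Integrable.of_bound (measurable_winProb θ hf hg).aestronglyMeasurable 1
    (Filter.Eventually.of_forall fun v => ?_)
  rw [Real.norm_of_nonneg (winProb_nonneg hθ _ _)]
  exact winProb_le_one hθ _ _

theorem integral_wonValue_bidLaw_right {w τ : Fin n → ℝ} (p : Fin n → ℝ)
    (hτ : ∀ b, τ b ∈ Set.Icc (0 : ℝ) 1) (c d μ : Fin n → ℝ) (x : Fin n → ℝ≥0) :
    ∫ y, wonValue w τ p x y ∂bidLaw c d μ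
      = ∑ b, w b * ∫ v, winProb (τ b) (x b + p b) (bid (c b) (d b) (μ b) v) ∂unif := by
  unfold bidLaw
  have hm : Measurable fun y => wonValue w τ p x y :=
    (measurable_wonValue w τ p).comp (measurable_const.prodMk measurable_id)
  rw [integral_map (measurable_bids c d μ).aemeasurable hm.aestronglyMeasurable]
  unfold wonValue
  rw [integral_finsetSum _ fun b _ => ((integrable_winProb (hτ b) measurable_const
    (measurable_bid (c b) (d b) (μ b)).coe_nnreal_real).const_mul _)]
  exact Finset.sum_congr rfl fun b _ => integral_const_mul _ _

theorem integral_wonValue_bidLaw_left {w τ : Fin n → ℝ} (p : Fin n → ℝ)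
    (hτ : ∀ b, τ b ∈ Set.Icc (0 : ℝ) 1) (c d μ : Fin n → ℝ) (y : Fin n → ℝ≥0) :
    ∫ x, wonValue w τ p x y ∂bidLaw c d μ
      = ∑ b, w b * ∫ v, winProb (τ b) (bid (c b) (d b) (μ b) v + p b) (y b) ∂unif := by
  unfold bidLaw
  have hm : Measurable fun x => wonValue w τ p x y :=
    (measurable_wonValue w τ p).comp (measurable_id.prodMk measurable_const)
  rw [integral_map (measurable_bids c d μ).aemeasurable hm.aestronglyMeasurable]
  unfold wonValue
  rw [integral_finsetSum _ fun b _ => ((integrable_winProb (hτ b)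
    ((measurable_bid (c b) (d b) (μ b)).coe_nnreal_real.add_const _) measurable_const).const_mul _)]
  exact Finset.sum_congr rfl fun b _ => integral_const_mul _ _

/-- Against a bid of B that is uniform on `[p, p + d μ]` with probability `μ`, a bid `z` of A on
top of the pre-allocation `p` wins with probability at most `1 - μ + z / d`. -/
theorem integral_winProb_le {θ : ℝ} (hθ : θ ∈ Set.Icc (0 : ℝ) 1) {p d μ z : ℝ} (hd : 0 < d)
    (h1 : μ ≤ 1) (hz : 0 ≤ z) :
    ∫ v, winProb θ (z + p) (bid p d μ v) ∂unif ≤ 1 - μ + z / d := by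
  have hzd : 0 ≤ z / d := by positivity
  -- `bid` decreases in `v` on `v < μ`, and `v < μ - z / d` is where B's bid exceeds `z + p`.
  have := integral_unif_le (r := μ - z / d) (by linarith)
    (integrable_winProb hθ (measurable_const (a := z + p)) (measurable_bid p d μ).coe_nnreal_real)
    (fun v => winProb_le_one hθ _ _) (fun v hv => by
      refine (winProb_of_lt θ ?_).le
      have hv' : v < μ := by linarith
      unfold bid
      rw [if_pos hv']
      refine lt_of_lt_of_le ?_ (Real.le_coe_toNNReal _)
      have : z / d < μ - v := by linarith
      rw [div_lt_iff₀ hd] at this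
      linarith)
  linarith

/-- Against a bid of A that is uniform on `[0, d ν]` with probability `ν`, on top of the
pre-allocation `p`, a bid `y` of B wins with probability at most `e + y / d`. -/
theorem le_integral_winProb {θ : ℝ} (hθ : θ ∈ Set.Icc (0 : ℝ) 1) {p d ν y e : ℝ} (hd : 0 < d)
    (h1 : ν ≤ 1) (hy : 0 ≤ y) (he : 0 ≤ e) (he' : 1 - (ν + p / d) ≤ e) :
    1 - (e + y / d) ≤ ∫ v, winProb θ (bid 0 d ν v + p) y ∂unif := by
  have hyd : 0 ≤ y / d := by positivity
  have hi := integrable_winProb hθ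
    ((measurable_bid 0 d ν).coe_nnreal_real.add_const p) (measurable_const (a := y))
  have key : ∫ v, (1 - winProb θ (bid 0 d ν v + p) y) ∂unif
      = 1 - ∫ v, winProb θ (bid 0 d ν v + p) y ∂unif := by
    rw [integral_sub (integrable_const 1) hi]
    simp
  -- If `y < p`, A wins outright. Otherwise `p / d ≤ y / d`, so every `v` below the threshold `ν + p
  -- / d - y / d` satisfies `v < ν`, where A's bid is active.
  rcases lt_or_ge y p with hyp | hyp
  · have : ∀ v, 1 - winProb θ (bid 0 d ν v + p) y = 0 := fun v => by
      rw [winProb_of_gt, sub_self]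
      have := (bid 0 d ν v).coe_nonneg
      linarith
    simp_rw [this] at key
    simp at key
    linarith
  · have hpd : p / d ≤ y / d := by gcongr
    have := integral_unif_le (r := ν + p / d - y / d) (by linarith)
      ((integrable_const (1 : ℝ)).sub hi)
      (fun v => by
        have := winProb_nonneg hθ (bid 0 d ν v + p) y
        simp only [Pi.sub_apply]
        linarith)
      (fun v hv => by
        simp only [Pi.sub_apply]
        rw [winProb_of_gt, sub_self]
        have hv' : v < ν := by linarith
        unfold bid
        rw [if_pos hv']
        have h2 : y / d - p / d < ν - v := by linarith
        rw [← sub_div, div_lt_iff₀ hd] at h2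
        have h3 := Real.le_coe_toNNReal (0 + d * (ν - v))
        linarith)
    simp only [Pi.sub_apply] at this
    linarith

/-! ### Contest probabilities and the system of budget equations. -/

/-- Probability that B contests a battlefield of relative pre-allocation `q`, for the reciprocal
multiplier `x` of A and the ratio `κ` of the multipliers. -/
noncomputable def contest (κ x q : ℝ) : ℝ := min 1 (max 0 (κ - q / x))

theorem contest_nonneg (κ x q : ℝ) : 0 ≤ contest κ x q := le_min zero_le_one (le_max_left _ _)

theorem contest_le_one (κ x q : ℝ) : contest κ x q ≤ 1 := min_le_left _ _

theorem contest_le {κ x q : ℝ} (hκ : 0 ≤ κ) (hx : 0 < x) (hq : 0 ≤ q) : contest κ x q ≤ κ := by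
  have : 0 ≤ q / x := by positivity
  exact (min_le_right _ _).trans (max_le hκ (by linarith))

theorem contest_mono {κ x x' q : ℝ} (hx : 0 < x) (hxx : x ≤ x') (hq : 0 ≤ q) :
    contest κ x q ≤ contest κ x' q := by
  unfold contest
  gcongr

theorem continuousAt_contest {κ x : ℝ} (hx : 0 < x) (q : ℝ) :
    ContinuousAt (fun z : ℝ × ℝ => contest z.1 z.2 q) (κ, x) := by
  unfold contest
  have : ContinuousAt (fun z : ℝ × ℝ => q / z.2) (κ, x) :=
    continuousAt_const.div continuousAt_snd hx.ne'
  exact continuousAt_const.min (continuousAt_const.max (continuousAt_fst.sub this))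

/-- Expected expenditure of A in the candidate equilibrium. -/
noncomputable def spendA (w q : Fin n → ℝ) (κ x : ℝ) : ℝ :=
  ∑ b, w b * (x * contest κ x (q b) ^ 2 / (2 * κ))

/-- Expected expenditure of B in the candidate equilibrium. -/
noncomputable def spendB (w q : Fin n → ℝ) (κ x : ℝ) : ℝ :=
  ∑ b, w b * (x * contest κ x (q b) ^ 2 / 2 + contest κ x (q b) * q b)

theorem continuousAt_spendA {w q : Fin n → ℝ} {κ x : ℝ} (hκ : 0 < κ) (hx : 0 < x) :
    ContinuousAt (fun z : ℝ × ℝ => spendA w q z.1 z.2) (κ, x) := by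
  unfold spendA
  refine tendsto_finsetSum _ fun b _ => ?_
  exact continuousAt_const.mul ((continuousAt_snd.mul
    ((continuousAt_contest hx (q b)).pow 2)).div (continuousAt_const.mul continuousAt_fst)
      (by simpa using hκ.ne'))

theorem continuousAt_spendB {w q : Fin n → ℝ} {κ x : ℝ} (hx : 0 < x) :
    ContinuousAt (fun z : ℝ × ℝ => spendB w q z.1 z.2) (κ, x) := by
  unfold spendB
  refine tendsto_finsetSum _ fun b _ => ?_
  have hc := continuousAt_contest (κ := κ) hx (q b)
  exact continuousAt_const.mul (((continuousAt_snd.mul (hc.pow 2)).div_const 2).add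
    (hc.mul continuousAt_const))

theorem spendB_eq {w q : Fin n → ℝ} {κ x : ℝ} (hκ : 0 < κ) :
    spendB w q κ x = κ * spendA w q κ x + ∑ b, w b * (contest κ x (q b) * q b) := by
  unfold spendA spendB
  rw [Finset.mul_sum, ← Finset.sum_add_distrib]
  refine Finset.sum_congr rfl fun b _ => ?_
  field_simp

/-- Each summand is `x` times a function that is nondecreasing in `x`, because contest probabilities
rise with `x`. Positive levels are therefore crossed strictly and only once, which gives continuity
of the solution without derivatives. -/
theorem spendA_superhomogeneous {w q : Fin n → ℝ} (hw : ∀ b, 0 < w b) (hq : ∀ b, 0 ≤ q b)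
    {κ x x' : ℝ} (hκ : 0 < κ) (hx : 0 < x) (hxx : x ≤ x') :
    x' / x * spendA w q κ x ≤ spendA w q κ x' := by
  unfold spendA
  rw [Finset.mul_sum]
  refine Finset.sum_le_sum fun b _ => ?_
  have h1 := contest_mono (κ := κ) hx hxx (hq b)
  have h0 := contest_nonneg κ x (q b)
  have hx' : 0 < x' := hx.trans_le hxx
  calc x' / x * (w b * (x * contest κ x (q b) ^ 2 / (2 * κ)))
      = w b * (x' * contest κ x (q b) ^ 2 / (2 * κ)) := by field_simp
    _ ≤ w b * (x' * contest κ x' (q b) ^ 2 / (2 * κ)) := by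
      have := (hw b).le
      gcongr

theorem spendA_lt {w q : Fin n → ℝ} (hw : ∀ b, 0 < w b) (hq : ∀ b, 0 ≤ q b)
    {κ x x' : ℝ} (hκ : 0 < κ) (hx : 0 < x) (hxx : x < x')
    (hpos : 0 < spendA w q κ x') : spendA w q κ x < spendA w q κ x' := by
  rcases le_or_gt (spendA w q κ x) 0 with h | h
  · exact h.trans_lt hpos
  · refine lt_of_lt_of_le ?_ (spendA_superhomogeneous hw hq hκ hx hxx.le)
    exact lt_mul_of_one_lt_left h ((one_lt_div hx).2 hxx)

theorem exists_spendA_eq {w q : Fin n → ℝ} (hw : ∀ b, 0 < w b) (hw1 : ∑ b, w b = 1)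
    (hq : ∀ b, 0 ≤ q b)
    {κ R : ℝ} (hκ : 0 < κ) (hR : 0 < R) :
    ∃ x, 0 < x ∧ spendA w q κ x = R := by
  set Q := ∑ b, q b with hQ
  have hQ0 : 0 ≤ Q := Finset.sum_nonneg fun b _ => hq b
  have hQb : ∀ b, q b ≤ Q := fun b => Finset.single_le_sum (fun b _ => hq b) (Finset.mem_univ b)
  set m := min 1 (κ / 2) with hm
  have hm0 : 0 < m := by positivity
  have hm1 : m ≤ 1 := min_le_left _ _
  -- At `x₁` the budget suffices even if every contest probability is `1`.
  set x₁ := 2 * κ * R with hx₁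
  have hx₁0 : 0 < x₁ := by positivity
  -- The summand `2 * Q / κ` forces `q b / x₂ ≤ κ / 2`, so contest probabilities are at least `m`;
  -- the summand `x₁ / m ^ 2` then makes the spending at least `R`.
  set x₂ := x₁ / m ^ 2 + 2 * Q / κ with hx₂
  have h12 : x₁ ≤ x₂ := by
    have h1 : x₁ ≤ x₁ / m ^ 2 := by
      rw [le_div_iff₀ (by positivity)]
      exact mul_le_of_le_one_right hx₁0.le (pow_le_one₀ hm0.le hm1)
    have : 0 ≤ 2 * Q / κ := by positivity
    linarith
  have hx₂0 : 0 < x₂ := hx₁0.trans_le h12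
  have hlow : spendA w q κ x₁ ≤ R := by
    calc spendA w q κ x₁ ≤ ∑ b, w b * R := by
          refine Finset.sum_le_sum fun b _ => mul_le_mul_of_nonneg_left ?_ (hw b).le
          rw [div_le_iff₀ (by positivity)]
          have := pow_le_one₀ (n := 2) (contest_nonneg κ x₁ (q b)) (contest_le_one κ x₁ (q b))
          calc x₁ * contest κ x₁ (q b) ^ 2 ≤ x₁ := mul_le_of_le_one_right hx₁0.le this
            _ = R * (2 * κ) := by rw [hx₁]; ring
      _ = R := by rw [← Finset.sum_mul, hw1, one_mul]
  have hhigh : R ≤ spendA w q κ x₂ := by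
    calc R = ∑ b, w b * R := by rw [← Finset.sum_mul, hw1, one_mul]
      _ ≤ spendA w q κ x₂ := by
          refine Finset.sum_le_sum fun b _ => mul_le_mul_of_nonneg_left ?_ (hw b).le
          have hc : m ≤ contest κ x₂ (q b) := by
            unfold contest
            refine min_le_min_left _ (le_max_of_le_right ?_)
            have : q b / x₂ ≤ κ / 2 := by
              rw [div_le_iff₀ hx₂0]
              have h3 : 2 * Q / κ ≤ x₂ := by
                have : 0 ≤ x₁ / m ^ 2 := by positivity
                linarith
              rw [div_le_iff₀ hκ] at h3
              linarith [hQb b]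
            linarith
          rw [le_div_iff₀ (by positivity)]
          have h4 : x₁ / m ^ 2 ≤ x₂ := by
            have : 0 ≤ 2 * Q / κ := by positivity
            linarith
          rw [div_le_iff₀ (by positivity)] at h4
          calc R * (2 * κ) = x₁ := by rw [hx₁]; ring
            _ ≤ x₂ * m ^ 2 := h4
            _ ≤ x₂ * contest κ x₂ (q b) ^ 2 := by gcongr
  have hcont : ContinuousOn (spendA w q κ) (Set.Icc x₁ x₂) := fun x hx =>
    ((continuousAt_spendA (w := w) (q := q) hκ (hx₁0.trans_le hx.1)).comp
      (f := fun x : ℝ => (κ, x)) (by fun_prop)).continuousWithinAt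
  obtain ⟨x, hx, hxR⟩ := intermediate_value_Icc h12 hcont ⟨hlow, hhigh⟩
  exact ⟨x, hx₁0.trans_le hx.1, hxR⟩

/-- The budget constraints of both players can be met with equality. -/
theorem exists_multipliers {w q : Fin n → ℝ} (hw : ∀ b, 0 < w b) (hw1 : ∑ b, w b = 1)
    (hq : ∀ b, 0 ≤ q b)
    {RA RB : ℝ} (hRA : 0 < RA) (hRB : 0 < RB) :
    ∃ κ x, 0 < κ ∧ 0 < x ∧ spendA w q κ x = RA ∧ spendB w q κ x = RB := by
  have hex : ∀ κ : ℝ, ∃ x, 0 < κ → 0 < x ∧ spendA w q κ x = RA := fun κ => by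
    by_cases hκ : 0 < κ
    · obtain ⟨x, hx⟩ := exists_spendA_eq hw hw1 hq hκ hRA
      exact ⟨x, fun _ => hx⟩
    · exact ⟨0, fun h => absurd h hκ⟩
  choose X hX using hex
  set P := ∑ b, w b * q b with hP
  have hP0 : 0 ≤ P := Finset.sum_nonneg fun b _ => mul_nonneg (hw b).le (hq b)
  have hXc : ∀ κ, 0 < κ → ContinuousAt X κ := by
    intro κ hκ
    obtain ⟨hx, hxR⟩ := hX κ hκ
    have hev : ∀ y, 0 < y → ContinuousAt (fun κ => spendA w q κ y) κ := fun y hy =>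
      (continuousAt_spendA (w := w) (q := q) hκ hy).comp
        (f := fun κ : ℝ => (κ, y)) (by fun_prop)
    -- A strict inequality between `RA` and the spending at a fixed point beside `X κ` persists for
    -- nearby `κ'`; superhomogeneity then keeps `X κ'` on the correct side of that point.
    rw [ContinuousAt, tendsto_order]
    constructor
    · intro a ha
      -- The maximum keeps the comparison point positive even when `a ≤ 0`.
      set y := max a (X κ / 2) with hy
      have hy0 : 0 < y := lt_max_of_lt_right (by linarith)
      have hyX : y < X κ := max_lt ha (by linarith)
      have hlt : spendA w q κ y < RA := by
        rw [← hxR]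
        exact spendA_lt hw hq hκ hy0 hyX (by rw [hxR]; exact hRA)
      filter_upwards [(hev y hy0).eventually_lt_const hlt, lt_mem_nhds hκ] with κ' h1 h2
      obtain ⟨hx', hxR'⟩ := hX κ' h2
      by_contra hcon
      have hle : X κ' ≤ y := (not_lt.1 hcon).trans (le_max_left _ _)
      have := spendA_superhomogeneous hw hq h2 hx' hle
      rw [hxR'] at this
      have h3 : RA ≤ y / X κ' * RA := le_mul_of_one_le_left hRA.le ((one_le_div hx').2 hle)
      linarith
    · intro a ha
      have ha0 : 0 < a := hx.trans ha
      have hlt : RA < spendA w q κ a := by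
        have h1 := spendA_superhomogeneous hw hq hκ hx ha.le
        rw [hxR] at h1
        exact (lt_mul_of_one_lt_left hRA ((one_lt_div hx).2 ha)).trans_le h1
      filter_upwards [(hev a ha0).eventually_const_lt hlt, lt_mem_nhds hκ] with κ' h1 h2
      obtain ⟨hx', hxR'⟩ := hX κ' h2
      by_contra hcon
      have hle : a ≤ X κ' := not_lt.1 hcon
      have := spendA_superhomogeneous hw hq h2 ha0 hle
      rw [hxR'] at this
      have h3 : spendA w q κ' a ≤ X κ' / a * spendA w q κ' a :=
        le_mul_of_one_le_left (hRA.trans h1).le ((one_le_div ha0).2 hle)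
      linarith
  -- On the curve `X`, `spendB_eq` and `contest_le` place B's spending between `κ * RA` and `κ * (RA
  -- + P)`, which dictates the endpoints for `κ`.
  have hk1 : 0 < RB / (RA + P) := by positivity
  have hk12 : RB / (RA + P) ≤ RB / RA := by
    gcongr
    linarith
  have hcont : ContinuousOn (fun κ => spendB w q κ (X κ))
      (Set.Icc (RB / (RA + P)) (RB / RA)) := fun κ hκ => by
    have hκ0 : 0 < κ := hk1.trans_le hκ.1
    exact ((continuousAt_spendB (w := w) (q := q) (hX κ hκ0).1).comp
      (f := fun κ : ℝ => (κ, X κ)) (continuousAt_id.prodMk (hXc κ hκ0))).continuousWithinAt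
  have hlow : spendB w q (RB / (RA + P)) (X (RB / (RA + P))) ≤ RB := by
    set κ := RB / (RA + P) with hκ
    obtain ⟨hx, hxR⟩ := hX κ hk1
    rw [spendB_eq hk1, hxR]
    have : ∑ b, w b * (contest κ (X κ) (q b) * q b) ≤ κ * P := by
      rw [hP, Finset.mul_sum]
      refine Finset.sum_le_sum fun b _ => ?_
      have h1 := mul_le_mul_of_nonneg_right (contest_le hk1.le hx (hq b)) (hq b)
      calc w b * (contest κ (X κ) (q b) * q b) ≤ w b * (κ * q b) :=
            mul_le_mul_of_nonneg_left h1 (hw b).le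
        _ = κ * (w b * q b) := by ring
    have h2 : κ * (RA + P) = RB := by rw [hκ]; field_simp
    linarith
  have hhigh : RB ≤ spendB w q (RB / RA) (X (RB / RA)) := by
    have hk2 : 0 < RB / RA := by positivity
    obtain ⟨hx, hxR⟩ := hX _ hk2
    rw [spendB_eq hk2, hxR, div_mul_cancel₀ _ hRA.ne']
    have : 0 ≤ ∑ b, w b * (contest (RB / RA) (X (RB / RA)) (q b) * q b) :=
      Finset.sum_nonneg fun b _ => mul_nonneg (hw b).le
        (mul_nonneg (contest_nonneg _ _ _) (hq b))
    linarith
  obtain ⟨κ, hκ, hκR⟩ := intermediate_value_Icc hk12 hcont ⟨hlow, hhigh⟩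
  have hκ0 : 0 < κ := hk1.trans_le hκ.1
  exact ⟨κ, X κ, hκ0, (hX κ hκ0).1, (hX κ hκ0).2, hκR⟩

/-! ### Zero-sum interchangeability and assembly of equilibria. -/

/-- Pass through the mixed pair `(FA, FB')`: B does not gain by moving to it from the first
equilibrium, nor A by moving to it from the second. -/
theorem IsStageTwoNash.payoffA_le_payoffA {w τ p : Fin n → ℝ} {RA RB : ℝ}
    {FA FB FA' FB' : Measure (Fin n → ℝ≥0)} (h : IsStageTwoNash w τ p RA RB FA FB)
    (h' : IsStageTwoNash w τ p RA RB FA' FB') :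
    payoffA w τ p FA FB ≤ payoffA w τ p FA' FB' := by
  have h1 := h.bestB FB' h'.memB
  have h2 := h'.bestA FA h.memA
  unfold payoffB at h1
  linarith

theorem IsStageTwoNash.payoffA_eq {w τ p : Fin n → ℝ} {RA RB : ℝ}
    {FA FB FA' FB' : Measure (Fin n → ℝ≥0)} (h : IsStageTwoNash w τ p RA RB FA FB)
    (h' : IsStageTwoNash w τ p RA RB FA' FB') :
    payoffA w τ p FA FB = payoffA w τ p FA' FB' :=
  le_antisymm (h.payoffA_le_payoffA h') (h'.payoffA_le_payoffA h)

/-- Continuation payoffs agree at each profile, so the two equilibria maximize the same function of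
`p`. -/
theorem IsSPEPayoff.unique {w τ : Fin n → ℝ} {P RA RB v v' : ℝ}
    (h : IsSPEPayoff w τ P RA RB v) (h' : IsSPEPayoff w τ P RA RB v') : v = v' := by
  obtain ⟨p, FA, FB, hS, rfl⟩ := h
  obtain ⟨p', FA', FB', hS', rfl⟩ := h'
  apply le_antisymm
  · rw [(hS.nash p hS.mem).payoffA_eq (hS'.nash p hS.mem)]
    exact hS'.optimal p hS.mem
  · rw [(hS'.nash p' hS'.mem).payoffA_eq (hS.nash p' hS'.mem)]
    exact hS.optimal p' hS'.mem

theorem isStageTwoNash_of_saddle {w τ p : Fin n → ℝ} {RA RB V : ℝ}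
    {FA FB : Measure (Fin n → ℝ≥0)} (hA : FA ∈ lottoStrategies n RA)
    (hB : FB ∈ lottoStrategies n RB)
    (hAV : ∀ GA ∈ lottoStrategies n RA, payoffA w τ p GA FB ≤ V)
    (hBV : ∀ GB ∈ lottoStrategies n RB, V ≤ payoffA w τ p FA GB) :
    IsStageTwoNash w τ p RA RB FA FB ∧ payoffA w τ p FA FB = V := by
  have hV : payoffA w τ p FA FB = V := le_antisymm (hAV FA hA) (hBV FB hB)
  refine ⟨⟨hA, hB, fun GA hGA => hV ▸ hAV GA hGA, fun GB hGB => ?_⟩, hV⟩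
  unfold payoffB
  linarith [hBV GB hGB]

/-- Continuations may be chosen arbitrarily profile by profile: the one chosen at `pStar` need not
be the given one, but it has the same payoff. -/
theorem isSPEPayoff_of_nash {w τ : Fin n → ℝ} {P RA RB V : ℝ} {pStar : Fin n → ℝ}
    (hp : pStar ∈ preallocations n P)
    (hex : ∀ p ∈ preallocations n P, ∃ FA FB, IsStageTwoNash w τ p RA RB FA FB)
    (hV : ∃ FA FB, IsStageTwoNash w τ pStar RA RB FA FB ∧ payoffA w τ pStar FA FB = V)
    (hle : ∀ p ∈ preallocations n P, ∀ FA FB, IsStageTwoNash w τ p RA RB FA FB →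
      payoffA w τ p FA FB ≤ V) : IsSPEPayoff w τ P RA RB V := by
  have hex' : ∀ p, ∃ FA FB, p ∈ preallocations n P → IsStageTwoNash w τ p RA RB FA FB := by
    intro p
    by_cases h : p ∈ preallocations n P
    · obtain ⟨FA, FB, hF⟩ := hex p h
      exact ⟨FA, FB, fun _ => hF⟩
    -- Off the feasible profiles the strategies are immaterial, so the zero measure serves.
    · exact ⟨0, 0, fun h' => absurd h' h⟩
  choose FA FB hF using hex'
  obtain ⟨FA', FB', hN, hV⟩ := hV
  have hv : V = payoffA w τ pStar (FA pStar) (FB pStar) := by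
    rw [← hV]
    exact hN.payoffA_eq (hF pStar hp)
  refine ⟨pStar, FA, FB, ⟨hp, hF, fun p hpm => ?_⟩, hv⟩
  rw [← hv]
  exact hle p hpm _ _ (hF p hpm)

/-! ### Second-stage equilibrium with real-time resources. -/

/-- Complementary slackness for the clamped contest probability: it is `0` with nonpositive slack,
`1` with nonnegative slack, or strictly between with zero slack. -/
theorem max_eq_clamp_mul {κ : ℝ} (hκ : 0 < κ) (r : ℝ) :
    max 0 (1 - (min 1 (max 0 (κ - r)) + r) / κ)
      = min 1 (max 0 (κ - r)) * (1 - (min 1 (max 0 (κ - r)) + r) / κ) := by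
  rcases le_or_gt κ r with h | h
  · have h1 : 1 ≤ r / κ := (one_le_div hκ).2 h
    rw [max_eq_left (a := (0 : ℝ)) (b := κ - r) (by linarith), min_eq_right zero_le_one, zero_add,
      zero_mul, max_eq_left (by linarith)]
  · rw [max_eq_right (a := (0 : ℝ)) (b := κ - r) (by linarith)]
    rcases le_or_gt 1 (κ - r) with h1 | h1
    · have h2 : (1 + r) / κ ≤ 1 := (div_le_one hκ).2 (by linarith)
      rw [min_eq_left h1, one_mul, max_eq_right (by linarith)]
    · rw [min_eq_right h1.le, sub_add_cancel, div_self hκ.ne', sub_self, mul_zero, max_self]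

theorem proportional_mem {w : Fin n → ℝ} (hw : ∀ b, 0 < w b) (hw1 : ∑ b, w b = 1) {P : ℝ}
    (hP : 0 ≤ P) : (fun b => w b * P) ∈ preallocations n P :=
  ⟨fun b => mul_nonneg (hw b).le hP, by rw [← Finset.sum_mul, hw1, one_mul]⟩

/-- What B's strategy of contesting battlefield `b` with probability `μ b` concedes to A. -/
theorem payoffA_le_of_bidLaw {w τ : Fin n → ℝ} (hw : ∀ b, 0 < w b) (hw1 : ∑ b, w b = 1)
    (hτ : ∀ b, τ b ∈ Set.Icc (0 : ℝ) 1)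
    {p μ : Fin n → ℝ} {RA x : ℝ} (hRA : 0 ≤ RA) (hx : 0 < x)
    (h1 : ∀ b, μ b ≤ 1) {GA : Measure (Fin n → ℝ≥0)} (hGA : GA ∈ lottoStrategies n RA) :
    payoffA w τ p GA (bidLaw p (fun b => w b * x) μ) ≤ ∑ b, w b * (1 - μ b) + RA / x := by
  have := payoffA_le (p := p) hw hw1 hτ (C := ∑ b, w b * (1 - μ b)) (s := 1 / x)
    (FB := bidLaw p (fun b => w b * x) μ) hRA (by positivity) hGA
    (Filter.Eventually.of_forall fun y => by
      rw [integral_wonValue_bidLaw_right p hτ, Finset.mul_sum, ← Finset.sum_add_distrib]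
      refine Finset.sum_le_sum fun b _ => ?_
      have hb := hw b
      calc _ ≤ w b * (1 - μ b + y b / (w b * x)) :=
            mul_le_mul_of_nonneg_left
              (integral_winProb_le (hτ b) (mul_pos hb hx) (h1 b) (y b).coe_nonneg) hb.le
        _ = _ := by field_simp)
  calc _ ≤ _ := this
    _ = _ := by ring

/-- What A's strategy of bidding on battlefield `b` with probability `ν b` guarantees. -/
theorem le_payoffA_of_bidLaw {w τ : Fin n → ℝ} (hw : ∀ b, 0 < w b) (hw1 : ∑ b, w b = 1)
    (hτ : ∀ b, τ b ∈ Set.Icc (0 : ℝ) 1)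
    {p ν e : Fin n → ℝ} {RB y : ℝ} (hRB : 0 ≤ RB) (hy : 0 < y)
    (h1 : ∀ b, ν b ≤ 1) (he : ∀ b, 0 ≤ e b)
    (he' : ∀ b, 1 - (ν b + p b / (w b * y)) ≤ e b)
    {GB : Measure (Fin n → ℝ≥0)} (hGB : GB ∈ lottoStrategies n RB) :
    ∑ b, w b * (1 - e b) - RB / y ≤ payoffA w τ p (bidLaw 0 (fun b => w b * y) ν) GB := by
  have := le_payoffA (p := p) hw hw1 hτ (C := ∑ b, w b * (1 - e b)) (s := 1 / y)
    (FA := bidLaw 0 (fun b => w b * y) ν) hRB (by positivity) hGB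
    (fun z => by
      rw [integral_wonValue_bidLaw_left p hτ, Finset.mul_sum, ← Finset.sum_sub_distrib]
      refine Finset.sum_le_sum fun b _ => ?_
      have hb := hw b
      calc w b * (1 - e b) - 1 / y * z b = w b * (1 - (e b + z b / (w b * y))) := by
            field_simp
            ring
        _ ≤ _ := mul_le_mul_of_nonneg_left (le_integral_winProb (hτ b) (mul_pos hb hy) (h1 b)
              (z b).coe_nonneg (he b) (he' b)) hb.le)
  calc _ = _ := by ring
    _ ≤ _ := this

/-- Both players' uniform parts have length `w b * x * μ b`, starting at `0` for A and at `p b` for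
B, so the total commitments share a range. The two guarantees coincide because the budgets are
exhausted and slackness is complementary. -/
theorem exists_stageTwoNash {w τ : Fin n → ℝ} (hw : ∀ b, 0 < w b) (hw1 : ∑ b, w b = 1)
    (hτ : ∀ b, τ b ∈ Set.Icc (0 : ℝ) 1)
    {p : Fin n → ℝ} (hp : ∀ b, 0 ≤ p b) {RA RB : ℝ} (hRA : 0 < RA)
    (hRB : 0 < RB) : ∃ κ x FA FB, 0 < κ ∧ 0 < x ∧ spendB w (fun b => p b / w b) κ x = RB ∧
      IsStageTwoNash w τ p RA RB FA FB ∧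
      payoffA w τ p FA FB = ∑ b, w b * (1 - contest κ x (p b / w b)) + RA / x := by
  obtain ⟨κ, x, hκ, hx, hA, hB⟩ := exists_multipliers hw hw1
    (q := fun b => p b / w b) (fun b => div_nonneg (hp b) (hw b).le) hRA hRB
  set μ : Fin n → ℝ := fun b => contest κ x (p b / w b) with hμ
  -- `e b` is the chance of winning that B gets beyond the linear return on its bid; it is positive
  -- only where A's bids and pre-allocation leave slack, and there `μ b = 1`.
  set e : Fin n → ℝ := fun b => max 0 (1 - (μ b / κ + p b / (w b * (κ * x)))) with he
  have hμ0 : ∀ b, 0 ≤ μ b := fun b => contest_nonneg _ _ _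
  have hμ1 : ∀ b, μ b ≤ 1 := fun b => contest_le_one _ _ _
  have hμκ : ∀ b, μ b / κ ≤ 1 := fun b => by
    rw [div_le_one hκ]
    exact contest_le hκ.le hx (div_nonneg (hp b) (hw b).le)
  have key : ∀ b, e b = μ b * (1 - (μ b / κ + p b / (w b * (κ * x)))) := fun b => by
    have hwb := hw b
    have hr : p b / (w b * (κ * x)) = p b / w b / x / κ := by field_simp
    simp only [he, hμ, hr, ← add_div]
    exact max_eq_clamp_mul hκ _
  refine ⟨κ, x, bidLaw 0 (fun b => w b * (κ * x)) (fun b => μ b / κ),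
    bidLaw p (fun b => w b * x) μ, hκ, hx, hB, ?_⟩
  apply isStageTwoNash_of_saddle
  · refine bidLaw_mem (fun _ => le_rfl) (fun b => (mul_pos (hw b) (mul_pos hκ hx)).le)
      (fun b => div_nonneg (hμ0 b) hκ.le) hμκ (le_of_eq ?_)
    rw [← hA]
    refine Finset.sum_congr rfl fun b _ => ?_
    simp only [hμ]
    field_simp
    ring
  · refine bidLaw_mem hp (fun b => (mul_pos (hw b) hx).le) hμ0 hμ1 (le_of_eq ?_)
    rw [← hB]
    refine Finset.sum_congr rfl fun b _ => ?_
    have := (hw b).ne'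
    simp only [hμ]
    field_simp
    ring
  · exact fun GA hGA => payoffA_le_of_bidLaw hw hw1 hτ hRA.le hx hμ1 hGA
  · intro GB hGB
    refine le_of_eq_of_le ?_ (le_payoffA_of_bidLaw hw hw1 hτ hRB.le (mul_pos hκ hx) hμκ
      (e := e) (fun b => le_max_left _ _) (fun b => le_max_right _ _) hGB)
    have h1 : RA / x = ∑ b, w b * (μ b ^ 2 / (2 * κ)) := by
      rw [← hA, spendA, Finset.sum_div]
      refine Finset.sum_congr rfl fun b _ => ?_
      simp only [hμ]
      field_simp
    have h2 : RB / (κ * x) = ∑ b, w b * (μ b ^ 2 / (2 * κ) + μ b * (p b / (w b * (κ * x)))) := by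
      rw [← hB, spendB, Finset.sum_div]
      refine Finset.sum_congr rfl fun b _ => ?_
      have := (hw b).ne'
      simp only [hμ]
      field_simp
    rw [h1, h2, ← Finset.sum_add_distrib, ← Finset.sum_sub_distrib]
    refine Finset.sum_congr rfl fun b _ => ?_
    rw [key b]
    have := (hw b).ne'
    field_simp
    ring

/-! ### Equilibrium payoff with real-time resources. -/

/-- B can contest every battlefield with the same probability. -/
theorem IsStageTwoNash.payoffA_le {w τ : Fin n → ℝ} (hw : ∀ b, 0 < w b) (hw1 : ∑ b, w b = 1)
    (hτ : ∀ b, τ b ∈ Set.Icc (0 : ℝ) 1)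
    {P RA RB μ x : ℝ} (hRA : 0 ≤ RA) {p : Fin n → ℝ}
    (hp : p ∈ preallocations n P) {FA FB : Measure (Fin n → ℝ≥0)}
    (hN : IsStageTwoNash w τ p RA RB FA FB) (hx : 0 < x) (h0 : 0 ≤ μ) (h1 : μ ≤ 1)
    (hb : x * μ ^ 2 / 2 + μ * P ≤ RB) : payoffA w τ p FA FB ≤ 1 - μ + RA / x := by
  have hmem : bidLaw p (fun b => w b * x) (fun _ => μ) ∈ lottoStrategies n RB := by
    refine bidLaw_mem hp.1 (fun b => (mul_pos (hw b) hx).le) (fun _ => h0) (fun _ => h1)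
      (le_trans (le_of_eq ?_) hb)
    rw [Finset.sum_add_distrib, ← Finset.sum_mul, hp.2]
    have : ∀ b, w b * x * μ ^ 2 / 2 = w b * (x * μ ^ 2 / 2) := fun b => by ring
    simp_rw [this]
    rw [← Finset.sum_mul, hw1]
    ring
  have h2 := hN.bestB _ hmem
  have h3 := payoffA_le_of_bidLaw hw hw1 hτ (p := p) (μ := fun _ => μ) hRA hx (fun _ => h1)
    hN.memA
  rw [← Finset.sum_mul, hw1] at h3
  unfold payoffB at h2
  linarith

theorem IsSPEPayoff.le {w τ : Fin n → ℝ} (hw : ∀ b, 0 < w b) (hw1 : ∑ b, w b = 1)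
    (hτ : ∀ b, τ b ∈ Set.Icc (0 : ℝ) 1)
    {P RA RB v μ x : ℝ} (hRA : 0 ≤ RA) (h : IsSPEPayoff w τ P RA RB v)
    (hx : 0 < x) (h0 : 0 ≤ μ) (h1 : μ ≤ 1) (hb : x * μ ^ 2 / 2 + μ * P ≤ RB) :
    v ≤ 1 - μ + RA / x := by
  obtain ⟨p, FA, FB, hS, rfl⟩ := h
  exact (hS.nash p hS.mem).payoffA_le hw hw1 hτ hRA hS.mem hx h0 h1 hb

/-- Proportional pre-allocation makes `p b / w b = P` on every battlefield, so B's equilibrium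
contest is uniform. B can afford the same uniform contest against any other profile, so no profile
does better. -/
theorem exists_isSPEPayoff_of_pos {w τ : Fin n → ℝ} (hw : ∀ b, 0 < w b) (hw1 : ∑ b, w b = 1)
    (hτ : ∀ b, τ b ∈ Set.Icc (0 : ℝ) 1)
    {P RA RB : ℝ} (hP : 0 ≤ P) (hRA : 0 < RA) (hRB : 0 < RB) :
    ∃ μ x, 0 ≤ μ ∧ μ ≤ 1 ∧ 0 < x ∧ x * μ ^ 2 / 2 + μ * P = RB ∧
      IsSPEPayoff w τ P RA RB (1 - μ + RA / x) := by
  have hmem := proportional_mem hw hw1 hP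
  obtain ⟨κ, x, FA, FB, hκ, hx, hB, hN, hV⟩ :=
    exists_stageTwoNash (RA := RA) (RB := RB) hw hw1 hτ hmem.1 hRA hRB
  have hq : ∀ b, w b * P / w b = P := fun b => by
    have := (hw b).ne'
    field_simp
  simp only [hq, spendB, ← Finset.sum_mul, hw1, one_mul] at hB hV
  refine ⟨contest κ x P, x, contest_nonneg _ _ _, contest_le_one _ _ _, hx, hB, ?_⟩
  refine isSPEPayoff_of_nash hmem (fun p hp => ?_) ⟨FA, FB, hN, hV⟩ fun p hp GA GB hG =>
    hG.payoffA_le hw hw1 hτ hRA.le hp hx (contest_nonneg _ _ _) (contest_le_one _ _ _) hB.le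
  obtain ⟨-, -, GA, GB, -, -, -, hG, -⟩ :=
    exists_stageTwoNash (RA := RA) (RB := RB) hw hw1 hτ hp.1 hRA hRB
  exact ⟨GA, GB, hG⟩

/-! ### No real-time resources: a fractional knapsack. -/

theorem ae_eq_zero_of_mem_lottoStrategies_zero {F : Measure (Fin n → ℝ≥0)}
    (hF : F ∈ lottoStrategies n 0) : ∀ᵐ x ∂F, x = 0 := by
  have h := hF.2
  rw [ENNReal.ofReal_zero, nonpos_iff_eq_zero, lintegral_eq_zero_iff
    (Finset.measurable_sum _ fun b _ => (measurable_pi_apply b).coe_nnreal_ennreal)] at h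
  filter_upwards [h] with x hx
  ext b
  simp only [Pi.zero_apply, Finset.sum_eq_zero_iff, Finset.mem_univ, true_implies] at hx
  simpa using hx b

/-- The contest probabilities that B can afford if A has no real-time resources. -/
def affordable (p : Fin n → ℝ) (R : ℝ) : Set (Fin n → ℝ) :=
  {f | (∀ b, f b ∈ Set.Icc (0 : ℝ) 1) ∧ ∑ b, p b * f b ≤ R}

theorem exists_isMaxOn_affordable (w p : Fin n → ℝ) {R : ℝ} (hR : 0 ≤ R) :
    ∃ f ∈ affordable p R, ∀ g ∈ affordable p R, ∑ b, w b * g b ≤ ∑ b, w b * f b := by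
  have hc : IsCompact (affordable p R) := by
    have h1 : IsCompact (Set.univ.pi fun _ : Fin n => Set.Icc (0 : ℝ) 1) :=
      isCompact_univ_pi fun _ => isCompact_Icc
    have h2 : IsClosed {f : Fin n → ℝ | ∑ b, p b * f b ≤ R} :=
      isClosed_le (by fun_prop) continuous_const
    convert h1.inter_right h2 using 1
    ext f
    simp only [affordable, Set.mem_inter_iff, Set.mem_univ_pi, Set.mem_ofPred_eq]
  obtain ⟨f, hf, hmax⟩ := hc.exists_isMaxOn ⟨0, fun b => by simp, by simpa using hR⟩
    (f := fun g : Fin n → ℝ => ∑ b, w b * g b) (by fun_prop)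
  exact ⟨f, hf, fun g hg => hmax hg⟩

theorem bid_zero_zero_zero (v : ℝ) : bid 0 0 0 v = 0 := by
  simp [bid]

theorem winProb_zero_add_le (a y : ℝ) (hy : 0 ≤ y) :
    a * (1 - winProb 0 a y) ≤ y := by
  unfold winProb
  split_ifs <;> linarith

/-- A can only bid zero. As ties go to B, matching `p b` wins, so winning with probability `g b`
costs at least `p b * g b`; bidding exactly `p b` with probability `f b` attains this bound. -/
theorem stageTwoNash_of_affordable {w τ : Fin n → ℝ} (hw : ∀ b, 0 < w b) (hw1 : ∑ b, w b = 1)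
    (hτ : ∀ b, τ b = 0)
    {p f : Fin n → ℝ} {RB : ℝ} (hp : ∀ b, 0 ≤ p b)
    (hRB : 0 ≤ RB) (hf : f ∈ affordable p RB)
    (hmax : ∀ g ∈ affordable p RB, ∑ b, w b * g b ≤ ∑ b, w b * f b) :
    ∃ FA FB, IsStageTwoNash w τ p 0 RB FA FB ∧ payoffA w τ p FA FB = 1 - ∑ b, w b * f b := by
  have hτ' : ∀ b, τ b ∈ Set.Icc (0 : ℝ) 1 := fun b => by simp [hτ b]
  refine ⟨bidLaw 0 0 0, bidLaw p 0 f, ?_⟩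
  apply isStageTwoNash_of_saddle
  · exact bidLaw_mem (fun _ => le_rfl) (fun _ => le_rfl) (fun _ => le_rfl)
      (fun _ => zero_le_one) (by simp)
  · refine bidLaw_mem hp (fun _ => le_rfl) (fun b => (hf.1 b).1) (fun b => (hf.1 b).2) ?_
    simpa using hf.2
  · intro GA hGA
    have h := payoffA_le (p := p) hw hw1 hτ' (C := 1 - ∑ b, w b * f b) (s := 0)
      (FB := bidLaw p 0 f) le_rfl le_rfl hGA (by
        filter_upwards [ae_eq_zero_of_mem_lottoStrategies_zero hGA] with x hx
        rw [integral_wonValue_bidLaw_right p hτ', ← hw1, ← Finset.sum_sub_distrib, zero_mul,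
          add_zero]
        refine Finset.sum_le_sum fun b _ => ?_
        rw [← mul_one_sub]
        refine mul_le_mul_of_nonneg_left (integral_unif_le (hf.1 b).2
          (integrable_winProb (hτ' b) measurable_const
            (measurable_bid (p b) _ (f b)).coe_nnreal_real)
          (fun v => winProb_le_one (hτ' b) _ _) fun v hv => ?_) (hw b).le
        simp [hx, bid, hv, winProb, hτ b, hp b])
    simpa using h
  · intro GB hGB
    have := hGB.1
    have hmeas : ∀ b, Measurable fun y : Fin n → ℝ≥0 => winProb 0 (p b) (y b : ℝ) := fun b =>
      measurable_winProb 0 measurable_const (measurable_pi_apply b).coe_nnreal_real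
    have h00 : (0 : ℝ) ∈ Set.Icc (0 : ℝ) 1 := by simp
    have hint : ∀ b, Integrable (fun y : Fin n → ℝ≥0 => winProb 0 (p b) (y b : ℝ)) GB :=
      fun b => Integrable.of_bound (hmeas b).aestronglyMeasurable 1
        (Filter.Eventually.of_forall fun y => by
          rw [Real.norm_of_nonneg (winProb_nonneg h00 _ _)]
          exact winProb_le_one h00 _ _)
    have hpay : payoffA w τ p (bidLaw 0 0 0) GB
        = ∑ b, w b * ∫ y, winProb 0 (p b) (y b : ℝ) ∂GB := by
      have h1 : payoffA w τ p (bidLaw 0 0 0) GB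
          = ∫ y, ∫ x, wonValue w τ p x y ∂bidLaw 0 0 0 ∂GB :=
        integral_prod_symm _ (integrable_wonValue hw hw1 hτ' p _ GB)
      rw [h1]
      simp_rw [integral_wonValue_bidLaw_left p hτ']
      simp only [Pi.zero_apply, bid_zero_zero_zero, NNReal.coe_zero, zero_add, hτ,
        integral_const, probReal_univ, one_smul]
      rw [integral_finsetSum _ fun b _ => (hint b).const_mul _]
      exact Finset.sum_congr rfl fun b _ => integral_const_mul _ _
    set g : Fin n → ℝ := fun b => 1 - ∫ y, winProb 0 (p b) (y b : ℝ) ∂GB with hg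
    have hgi : ∀ b, g b = ∫ y, (1 - winProb 0 (p b) (y b : ℝ)) ∂GB := fun b => by
      rw [integral_sub (integrable_const 1) (hint b)]
      simp [hg]
    have hgm : g ∈ affordable p RB := by
      refine ⟨fun b => ⟨?_, ?_⟩, ?_⟩
      · rw [hgi]
        exact integral_nonneg fun y => sub_nonneg.2 (winProb_le_one h00 _ _)
      · have : 0 ≤ ∫ y, winProb 0 (p b) (y b : ℝ) ∂GB :=
          integral_nonneg fun y => winProb_nonneg h00 _ _
        simp only [hg]
        linarith
      · refine le_trans ?_ (integral_expenditure_le hRB hGB)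
        simp_rw [hgi, ← integral_const_mul]
        have hi : ∀ b, Integrable (fun y : Fin n → ℝ≥0 =>
            p b * (1 - winProb 0 (p b) (y b : ℝ))) GB := fun b =>
          ((integrable_const 1).sub (hint b)).const_mul _
        rw [← integral_finsetSum _ fun b _ => hi b]
        exact integral_mono (integrable_finsetSum _ fun b _ => hi b)
          (integrable_expenditure hGB)
          fun y => Finset.sum_le_sum fun b _ => winProb_zero_add_le _ _ (y b).coe_nonneg
    have h2 := hmax g hgm
    have h3 : ∑ b, w b * g b = 1 - ∑ b, w b * ∫ y, winProb 0 (p b) (y b : ℝ) ∂GB := by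
      rw [← hw1, ← Finset.sum_sub_distrib]
      exact Finset.sum_congr rfl fun b _ => by simp only [hg]; ring
    rw [hpay]
    linarith

theorem exists_isSPEPayoff_of_ties_zero {w τ : Fin n → ℝ} (hw : ∀ b, 0 < w b) (hw1 : ∑ b, w b = 1)
    (hτ : ∀ b, τ b = 0)
    {P RB : ℝ} (hP : 0 ≤ P) (hRB : 0 ≤ RB) :
    ∃ v, IsSPEPayoff w τ P 0 RB v := by
  have hmem := proportional_mem hw hw1 hP
  obtain ⟨f, hf, hmax⟩ := exists_isMaxOn_affordable w (fun b => w b * P) hRB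
  have hφ0 : 0 ≤ ∑ b, w b * f b :=
    Finset.sum_nonneg fun b _ => mul_nonneg (hw b).le (hf.1 b).1
  have hφ1 : ∑ b, w b * f b ≤ 1 := by
    rw [← hw1]
    exact Finset.sum_le_sum fun b _ => mul_le_of_le_one_right (hw b).le (hf.1 b).2
  refine ⟨1 - ∑ b, w b * f b, isSPEPayoff_of_nash hmem (fun p hp => ?_)
    (stageTwoNash_of_affordable hw hw1 hτ hmem.1 hRB hf hmax) fun p hp FA FB hN => ?_⟩
  · obtain ⟨g, hg, hgmax⟩ := exists_isMaxOn_affordable w p hRB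
    obtain ⟨FA, FB, hN, -⟩ := stageTwoNash_of_affordable hw hw1 hτ hp.1 hRB hg hgmax
    exact ⟨FA, FB, hN⟩
  · obtain ⟨g, hg, hgmax⟩ := exists_isMaxOn_affordable w p hRB
    obtain ⟨FA', FB', hN', hV⟩ := stageTwoNash_of_affordable hw hw1 hτ hp.1 hRB hg hgmax
    rw [hN.payoffA_eq hN', hV]
    -- Against any `p`, B can contest uniformly with the value-weighted mean of `f`. This costs `P`
    -- times that mean, which is what `f` costs against the proportional profile.
    have h1 := hgmax (fun _ => ∑ b, w b * f b) ⟨fun _ => ⟨hφ0, hφ1⟩, by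
      rw [← Finset.sum_mul, hp.2, Finset.mul_sum]
      refine le_trans (le_of_eq (Finset.sum_congr rfl fun b _ => ?_)) hf.2
      ring⟩
    rw [← Finset.sum_mul, hw1] at h1
    linarith

/-! ### Bounds and optimality for the investment problem. -/

/-- For a fixed contest probability B does best with the largest `x`, the one that exhausts its
budget. -/
theorem IsSPEPayoff.le_of_contest {w τ : Fin n → ℝ} (hw : ∀ b, 0 < w b) (hw1 : ∑ b, w b = 1)
    (hτ : ∀ b, τ b ∈ Set.Icc (0 : ℝ) 1)
    {P RA RB v μ : ℝ} (hRA : 0 ≤ RA)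
    (h : IsSPEPayoff w τ P RA RB v) (h0 : 0 < μ) (h1 : μ ≤ 1) (hb : μ * P < RB) :
    v ≤ 1 - μ + RA * μ ^ 2 / (2 * (RB - μ * P)) := by
  have hD : 0 < RB - μ * P := by linarith
  refine (h.le hw hw1 hτ (x := 2 * (RB - μ * P) / μ ^ 2) hRA (by positivity) h0.le h1
    (le_of_eq ?_)).trans (le_of_eq ?_)
  · field_simp
    ring
  · field_simp

theorem exists_contest_of_pos {w τ : Fin n → ℝ} (hw : ∀ b, 0 < w b) (hw1 : ∑ b, w b = 1)
    (hτ : ∀ b, τ b ∈ Set.Icc (0 : ℝ) 1)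
    {P RA RB : ℝ} (hP : 0 ≤ P) (hRA : 0 < RA) (hRB : 0 < RB) :
    ∃ μ, 0 < μ ∧ μ ≤ 1 ∧ μ * P < RB ∧
      IsSPEPayoff w τ P RA RB (1 - μ + RA * μ ^ 2 / (2 * (RB - μ * P))) := by
  obtain ⟨μ, x, h0, h1, hx, hb, hS⟩ := exists_isSPEPayoff_of_pos hw hw1 hτ hP hRA hRB
  have hμ : 0 < μ := by
    refine h0.lt_of_ne fun h => ?_
    rw [← h] at hb
    norm_num at hb
    exact hRB.ne hb
  have hD : RB - μ * P = x * μ ^ 2 / 2 := by linarith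
  refine ⟨μ, hμ, h1, sub_pos.1 (hD ▸ by positivity), ?_⟩
  convert hS using 2
  rw [hD]
  field_simp

/-- The upper bound for the payoff of an investment when B contests with a probability `m` that is
small enough for pre-allocated resources not to be worth their price. -/
theorem IsSPEPayoff.le_of_feasible {w τ : Fin n → ℝ} (hw : ∀ b, 0 < w b) (hw1 : ∑ b, w b = 1)
    (hτ : ∀ b, τ b ∈ Set.Icc (0 : ℝ) 1)
    {P R RB M c m v : ℝ} (hM : 0 < M) (hRB : 0 < RB)
    (h : IsSPEPayoff w τ P R RB v) (hf : (P, R) ∈ feasibleInvestments M c)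
    (h0 : 0 < m) (h1 : m ≤ 1) (hm : m * M ≤ c * RB) :
    v ≤ 1 - m + M * m ^ 2 / (2 * RB) ∧
      (1 - m + M * m ^ 2 / (2 * RB) ≤ v →
        R = M - c * P ∧ 0 < R ∧ m * P < RB ∧ (m * M < c * RB → P = 0)) := by
  obtain ⟨hP, hR, hf⟩ := hf
  simp only at hP hR hf
  have hpos : 0 < M * m ^ 2 / (2 * RB) := by positivity
  rcases lt_or_ge (c * P) M with hlt | hge
  · have hmP : m * P < RB := by
      have h2 : m * M * P ≤ c * RB * P := mul_le_mul_of_nonneg_right hm hP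
      have h3 : c * P * RB < M * RB := mul_lt_mul_of_pos_right hlt hRB
      refine lt_of_mul_lt_mul_right (a := M) ?_ hM.le
      linarith
    have hD : 0 < RB - m * P := by linarith
    have hv := h.le_of_contest hw hw1 hτ hR h0 h1 hmP
    have hmcP : m * M * P ≤ c * RB * P := mul_le_mul_of_nonneg_right hm hP
    have hRRB : R * RB ≤ (M - c * P) * RB := mul_le_mul_of_nonneg_right (by linarith) hRB.le
    have hm2 : 0 < m ^ 2 := by positivity
    constructor
    · refine hv.trans (add_le_add_right ?_ _)
      rw [div_le_div_iff₀ (by positivity) (by positivity)]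
      have : m ^ 2 * (R * RB) ≤ m ^ 2 * (M * (RB - m * P)) :=
        mul_le_mul_of_nonneg_left (by linarith) hm2.le
      linarith
    · intro hle
      have h2 : M * m ^ 2 / (2 * RB) ≤ R * m ^ 2 / (2 * (RB - m * P)) := by linarith
      rw [div_le_div_iff₀ (by positivity) (by positivity)] at h2
      have h3 : M * (RB - m * P) ≤ R * RB := by
        refine le_of_mul_le_mul_right (a := m ^ 2) ?_ hm2
        linarith
      have hReq : R = M - c * P := by
        refine le_antisymm (by linarith) ?_
        refine le_of_mul_le_mul_right (a := RB) ?_ hRB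
        linarith
      refine ⟨hReq, by linarith, hmP, fun hlt' => ?_⟩
      by_contra hP0
      have hP' : 0 < P := lt_of_le_of_ne hP (Ne.symm hP0)
      have := mul_lt_mul_of_pos_right hlt' hP'
      linarith
  · have hR0 : R = 0 := le_antisymm (by linarith) hR
    have hcP : c * P ≤ M := by linarith
    have hv : v ≤ 1 - m := by
      have : m ≤ 1 - v := by
        -- When A spends everything on pre-allocation, `m * P = RB` is possible, so `m` itself may
        -- be inadmissible and is approached from below.
        refine le_of_forall_lt_imp_le_of_dense fun μ hμ => ?_
        rcases le_or_gt μ 0 with hμ0 | hμ0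
        · have h5 := h.le hw hw1 hτ (μ := 0) (x := 1) hR one_pos le_rfl zero_le_one
            (by simpa using hRB.le)
          rw [hR0] at h5
          norm_num at h5
          linarith
        · have hPpos : 0 < P := by
            refine lt_of_le_of_ne hP fun h' => ?_
            rw [← h'] at hge
            linarith
          have hμP : μ * P < RB := by
            have h2 : m * M * P ≤ c * RB * P := mul_le_mul_of_nonneg_right hm hP
            have h3 : c * P * RB ≤ M * RB := mul_le_mul_of_nonneg_right hcP hRB.le
            have h4 : m * P ≤ RB := by
              refine le_of_mul_le_mul_right (a := M) ?_ hM
              linarith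
            exact (mul_lt_mul_of_pos_right hμ hPpos).trans_le h4
          have h5 := h.le_of_contest hw hw1 hτ hR hμ0 (hμ.le.trans h1) hμP
          rw [hR0] at h5
          norm_num at h5
          linarith
      linarith
    exact ⟨by linarith, fun hle => by linarith⟩

/-- The payoff against a contest probability `μ`, compared with its value at the critical
probability `c * RB / M`. -/
theorem le_contest_payoff_iff {P R RB M c m μ : ℝ} (hRB : 0 < RB) (hm : m * M = c * RB)
    (hR : R = M - c * P) (hμP : μ * P < RB) :
    1 - m + M * m ^ 2 / (2 * RB) ≤ 1 - μ + R * μ ^ 2 / (2 * (RB - μ * P)) ↔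
      0 ≤ (μ - m) * ((2 * P + R) * μ - RB * (2 - c)) := by
  have hD : 0 < 2 * (RB - μ * P) := by linarith
  have h1 : M * m ^ 2 / (2 * RB) = c * m / 2 := by
    rw [div_eq_div_iff (by positivity) two_ne_zero]
    linear_combination (2 * m) * hm
  have h2 : (μ - m) * ((2 * P + R) * μ - RB * (2 - c))
      = (m - μ - c * m / 2) * (2 * (RB - μ * P)) + R * μ ^ 2 := by
    linear_combination (-μ) * hm - m * μ * hR
  rw [h1, h2, ← sub_nonneg]
  have h3 : 1 - μ + R * μ ^ 2 / (2 * (RB - μ * P)) - (1 - m + c * m / 2)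
      = ((m - μ - c * m / 2) * (2 * (RB - μ * P)) + R * μ ^ 2) / (2 * (RB - μ * P)) := by
    rw [eq_div_iff hD.ne']
    linear_combination div_mul_cancel₀ (R * μ ^ 2) hD.ne'
  rw [h3]
  constructor
  · intro h
    by_contra hneg
    exact absurd h (not_le.2 (div_neg_of_neg_of_pos (not_le.1 hneg) hD))
  · exact fun h => div_nonneg h hD.le

theorem isOptimalInvestment_iff {w τ : Fin n → ℝ} {M c RB V P₀ R₀ : ℝ}
    (hub : ∀ y ∈ feasibleInvestments M c, ∀ u, IsSPEPayoff w τ y.1 y.2 RB u → u ≤ V)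
    (hf₀ : (P₀, R₀) ∈ feasibleInvestments M c) (h₀ : IsSPEPayoff w τ P₀ R₀ RB V) (P R v : ℝ) :
    IsOptimalInvestment w τ M c RB P R v ↔
      (P, R) ∈ feasibleInvestments M c ∧ IsSPEPayoff w τ P R RB v ∧ v = V := by
  constructor
  · rintro ⟨hf, hS, hopt⟩
    exact ⟨hf, hS, le_antisymm (hub _ hf _ hS) (hopt _ hf₀ _ h₀)⟩
  · rintro ⟨hf, hS, rfl⟩
    exact ⟨hf, hS, hub⟩

/-- If pre-allocated resources are expensive, the optimal investment is purely real-time. -/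
theorem isOptimalInvestment_iff_of_expensive {w τ : Fin n → ℝ} (hw : ∀ b, 0 < w b)
    (hw1 : ∑ b, w b = 1) (hτ : ∀ b, τ b ∈ Set.Icc (0 : ℝ) 1)
    {M c RB m : ℝ} (hM : 0 < M)
    (hRB : 0 < RB) (hm : m = min 1 (RB / M)) (hmc : m * M < c * RB) (P R v : ℝ) :
    IsOptimalInvestment w τ M c RB P R v ↔
      (P = 0 ∧ R = M) ∧ v = 1 - m + M * m ^ 2 / (2 * RB) := by
  have h0 : 0 < m := hm ▸ lt_min one_pos (by positivity)
  have h1 : m ≤ 1 := hm ▸ min_le_left _ _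
  have hub : ∀ y ∈ feasibleInvestments M c, ∀ u, IsSPEPayoff w τ y.1 y.2 RB u →
      u ≤ 1 - m + M * m ^ 2 / (2 * RB) := fun y hy u hu =>
    (hu.le_of_feasible hw hw1 hτ hM hRB hy h0 h1 hmc.le).1
  have hf₀ : ((0 : ℝ), M) ∈ feasibleInvestments M c := ⟨le_rfl, hM.le, by simp⟩
  have h₀ : IsSPEPayoff w τ 0 M RB (1 - m + M * m ^ 2 / (2 * RB)) := by
    obtain ⟨μ, hμ0, hμ1, -, hS⟩ := exists_contest_of_pos hw hw1 hτ (P := 0) le_rfl hM hRB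
    have hle := hub _ hf₀ _ hS
    rw [mul_zero, sub_zero] at hle hS
    convert hS using 1
    refine le_antisymm ?_ hle
    -- If `m = 1`, both factors are nonpositive; if `m = RB / M`, the product is `M * (μ - m) ^ 2`.
    have hQ : 0 ≤ (μ - m) * (M * (μ + m) - 2 * RB) := by
      rcases le_total 1 (RB / M) with h | h
      · rw [min_eq_left h] at hm
        rw [one_le_div hM] at h
        have : M * (μ + m) ≤ RB * 2 := by
          rw [hm]
          gcongr
          linarith
        exact mul_nonneg_of_nonpos_of_nonpos (by linarith) (by linarith)
      · rw [min_eq_right h] at hm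
        have : RB = m * M := by rw [hm]; field_simp
        rw [this]
        have : 0 ≤ M * (μ - m) ^ 2 := by positivity
        linarith
    have : 1 - μ + M * μ ^ 2 / (2 * RB) - (1 - m + M * m ^ 2 / (2 * RB))
        = (μ - m) * (M * (μ + m) - 2 * RB) / (2 * RB) := by
      field_simp
      ring
    have h2 : 0 ≤ (μ - m) * (M * (μ + m) - 2 * RB) / (2 * RB) := by positivity
    linarith
  rw [isOptimalInvestment_iff hub hf₀ h₀]
  constructor
  · rintro ⟨hf, hS, hv⟩
    obtain ⟨hR, -, -, hP⟩ := (hS.le_of_feasible hw hw1 hτ hM hRB hf h0 h1 hmc.le).2 hv.ge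
    have hP := hP hmc
    exact ⟨⟨hP, by rw [hR, hP]; ring⟩, hv⟩
  · rintro ⟨⟨rfl, rfl⟩, rfl⟩
    exact ⟨hf₀, h₀, rfl⟩

/-- The optimal investments if pre-allocated resources are cheap. -/
theorem isOptimalInvestment_iff_of_cheap {w τ : Fin n → ℝ} (hw : ∀ b, 0 < w b)
    (hw1 : ∑ b, w b = 1) (hτ : ∀ b, τ b ∈ Set.Icc (0 : ℝ) 1)
    {M c RB m Q : ℝ} (hM : 0 < M) (hc : 0 < c)
    (hc1 : c ≤ 1) (hRB : 0 < RB) (hmM : m * M = c * RB) (h1 : m ≤ 1)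
    (hQ : Q = 2 * (1 - c) / (2 - c) * (M / c)) (P R v : ℝ) :
    IsOptimalInvestment w τ M c RB P R v ↔
      ((0 ≤ P ∧ P ≤ Q ∧ (m < 1 → P = Q)) ∧ R = M - c * P) ∧
        v = 1 - m + M * m ^ 2 / (2 * RB) := by
  have h2c : 0 < 2 - c := by linarith
  have h0 : 0 < m := by
    refine lt_of_mul_lt_mul_right (a := M) ?_ hM.le
    rw [hmM, zero_mul]
    positivity
  have hQ0 : 0 ≤ Q := by
    have : 0 ≤ 1 - c := by linarith
    rw [hQ]
    positivity
  have hQc : Q * ((2 - c) * c) = 2 * M * (1 - c) := by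
    rw [hQ]
    field_simp
  have hub : ∀ y ∈ feasibleInvestments M c, ∀ u, IsSPEPayoff w τ y.1 y.2 RB u →
      u ≤ 1 - m + M * m ^ 2 / (2 * RB) := fun y hy u hu =>
    (hu.le_of_feasible hw hw1 hτ hM hRB hy h0 h1 hmM.le).1
  have hR0 : ∀ P, P ≤ Q → 0 < M - c * P := fun P hPQ => by
    have h3 : P * ((2 - c) * c) ≤ 2 * M * (1 - c) := by
      rw [← hQc]
      gcongr
    refine lt_of_mul_lt_mul_right (a := 2 - c) ?_ h2c.le
    have : 0 < M * c := by positivity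
    linarith
  have hfeas : ∀ P, 0 ≤ P → P ≤ Q → (P, M - c * P) ∈ feasibleInvestments M c :=
    fun P hP hPQ => ⟨hP, (hR0 P hPQ).le, by simp⟩
  -- This is the origin of `Q`: up to positive factors, the second factor of the quadratic at `μ =
  -- m` equals `P - Q`.
  have hslope : ∀ P, (2 * P + (M - c * P)) * m * M - RB * (2 - c) * M
      = RB * (P - Q) * ((2 - c) * c) := fun P => by
    linear_combination (2 * P + (M - c * P)) * hmM + RB * hQc
  have hatt : ∀ P, 0 ≤ P → P ≤ Q → (m < 1 → P = Q) →
      IsSPEPayoff w τ P (M - c * P) RB (1 - m + M * m ^ 2 / (2 * RB)) := by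
    intro P hP hPQ hm
    obtain ⟨μ, hμ0, hμ1, hμP, hS⟩ := exists_contest_of_pos hw hw1 hτ hP (hR0 P hPQ) hRB
    have hle := hub _ (hfeas P hP hPQ) _ hS
    convert hS using 1
    refine le_antisymm ((le_contest_payoff_iff hRB hmM rfl hμP).2 ?_) hle
    have hA : 0 < 2 * P + (M - c * P) := by linarith [hR0 P hPQ]
    -- For `m < 1` the choice `P = Q` makes `m` a double root. For `m = 1` only `μ ≤ m` is
    -- admissible, so it is enough that the second factor is nonpositive there.
    rcases h1.lt_or_eq with hlt | heq
    · have h3 := hslope P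
      rw [hm hlt, sub_self, mul_zero, zero_mul, ← sub_mul] at h3
      have h4 := (mul_eq_zero.1 h3).resolve_right hM.ne'
      rw [← hm hlt] at h4
      have : RB * (2 - c) = (2 * P + (M - c * P)) * m := by linarith
      rw [this]
      have : 0 ≤ (2 * P + (M - c * P)) * (μ - m) ^ 2 := by positivity
      linarith
    · have h3 : (2 * P + (M - c * P)) * m * M - RB * (2 - c) * M ≤ 0 := by
        rw [hslope]
        exact mul_nonpos_of_nonpos_of_nonneg
          (mul_nonpos_of_nonneg_of_nonpos hRB.le (by linarith)) (by positivity)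
      rw [← sub_mul] at h3
      have h4 := nonpos_of_mul_nonpos_left h3 hM
      have h5 : (2 * P + (M - c * P)) * μ ≤ (2 * P + (M - c * P)) * m := by
        gcongr
        linarith
      exact mul_nonneg_of_nonpos_of_nonpos (by linarith) (by linarith)
  rw [isOptimalInvestment_iff hub (hfeas Q hQ0 le_rfl) (hatt Q hQ0 le_rfl fun _ => rfl)]
  constructor
  · rintro ⟨hf, hS, hv⟩
    obtain ⟨hR, hRpos, hmP, -⟩ :=
      (hS.le_of_feasible hw hw1 hτ hM hRB hf h0 h1 hmM.le).2 hv.ge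
    have hP : 0 ≤ P := hf.1
    have key : ∀ μ, 0 < μ → μ ≤ 1 → μ * P < RB →
        0 ≤ (μ - m) * ((2 * P + R) * μ - RB * (2 - c)) := fun μ hμ0 hμ1 hμP =>
      (le_contest_payoff_iff hRB hmM hR hμP).1
        (hv ▸ hS.le_of_contest hw hw1 hτ hRpos.le hμ0 hμ1 hμP)
    have hA : 0 < 2 * P + R := by linarith
    set ρ := RB * (2 - c) / (2 * P + R) with hρ
    have hρe : (2 * P + R) * ρ = RB * (2 - c) := by
      rw [hρ]
      field_simp
    have hρ0 : 0 < ρ := by positivity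
    have hfac : ∀ μ, (μ - m) * ((2 * P + R) * μ - RB * (2 - c))
        = (2 * P + R) * ((μ - m) * (μ - ρ)) := fun μ => by
      linear_combination (μ - m) * hρe
    have key' : ∀ μ, 0 < μ → μ ≤ 1 → μ * P < RB → 0 ≤ (μ - m) * (μ - ρ) :=
      fun μ hμ0 hμ1 hμP => by
        have h3 := key μ hμ0 hμ1 hμP
        rw [hfac] at h3
        exact nonneg_of_mul_nonneg_right h3 hA
    have hmρ : m ≤ ρ := by
      by_contra hlt
      rw [not_le] at hlt
      -- Between the roots the quadratic is negative, and the midpoint is admissible because it lies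
      -- below `m`.
      have h3 := key' ((m + ρ) / 2) (by positivity) (by linarith)
        (lt_of_le_of_lt (mul_le_mul_of_nonneg_right (by linarith) hP) hmP)
      have h4 : ((m + ρ) / 2 - m) * ((m + ρ) / 2 - ρ) = -((m - ρ) / 2) ^ 2 := by ring
      have h5 : 0 < ((m - ρ) / 2) ^ 2 := by
        have : 0 < m - ρ := by linarith
        positivity
      linarith
    have hsl := hslope P
    rw [← hR, ← hρe] at hsl
    have hcc : 0 < (2 - c) * c := by positivity
    have hsl' : (2 * P + R) * M * (m - ρ) = RB * ((2 - c) * c) * (P - Q) := by linarith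
    have hAM : 0 < (2 * P + R) * M := by positivity
    have hRc : 0 < RB * ((2 - c) * c) := by positivity
    refine ⟨⟨⟨hP, ?_, fun hm1 => ?_⟩, hR⟩, hv⟩
    · by_contra hlt
      have h3 : 0 < RB * ((2 - c) * c) * (P - Q) := mul_pos hRc (by linarith)
      have h4 : (2 * P + R) * M * (m - ρ) ≤ 0 :=
        mul_nonpos_of_nonneg_of_nonpos hAM.le (by linarith)
      linarith
    · have hρm : ρ ≤ m := by
        by_contra hlt
        rw [not_le] at hlt
        -- Room to move right of `m` while keeping `μ * P < RB`; the `+ 1` covers `P = 0`.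
        have hgap : 0 < (RB - m * P) / (P + 1) := div_pos (by linarith) (by linarith)
        obtain ⟨μ, hmμ, hμ⟩ : ∃ μ, m < μ ∧ μ < min (min ρ 1) (m + (RB - m * P) / (P + 1)) :=
          exists_between (lt_min (lt_min hlt hm1) (by linarith))
        obtain ⟨⟨hμρ, hμ1⟩, hμg⟩ := (lt_min_iff.trans (and_congr_left' lt_min_iff)).1 hμ
        have h3 : (μ - m) * (P + 1) < RB - m * P :=
          (lt_div_iff₀ (by linarith)).1 (by linarith)
        have h4 := key' μ (by linarith) hμ1.le (by linarith)
        have h5 : (μ - m) * (μ - ρ) < 0 := mul_neg_of_pos_of_neg (by linarith) (by linarith)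
        linarith
      have hρm' : m - ρ = 0 := by linarith
      rw [hρm', mul_zero] at hsl'
      have := (mul_eq_zero.1 hsl'.symm).resolve_left hRc.ne'
      linarith
  · rintro ⟨⟨⟨hP, hPQ, hm⟩, rfl⟩, rfl⟩
    exact ⟨hfeas P hP hPQ, hatt P hP hPQ hm, rfl⟩

end GeneralLotto

/-! ### Translation into the threshold `t`. -/

theorem mainTheorem3 (n : ℕ) (w τ : Fin n → ℝ)
    (hw : ∀ b, 0 < w b) (hw1 : ∑ b, w b = 1) (hτ : ∀ b, τ b ∈ Set.Icc (0 : ℝ) 1)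
    (MA cA RB : ℝ) (hMA : 0 < MA) (hcA : 0 < cA) (hRB : 0 < RB)
    (t : ℝ) (ht : t = min 1 (MA / RB)) :
    -- the equilibrium payoff is well defined
    (∀ P RA : ℝ, 0 ≤ P → 0 ≤ RA →
      (∀ v v' : ℝ, GeneralLotto.IsSPEPayoff w τ P RA RB v →
        GeneralLotto.IsSPEPayoff w τ P RA RB v' → v = v') ∧
      ((0 < RA ∨ ∀ b, τ b = 0) → ∃ v : ℝ, GeneralLotto.IsSPEPayoff w τ P RA RB v)) ∧
    -- the optimal investments
    (∀ P RA : ℝ, (∃ v : ℝ, GeneralLotto.IsOptimalInvestment w τ MA cA RB P RA v) ↔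
      ((cA < t → P = 2 * (1 - cA) / (2 - cA) * (MA / cA)) ∧
       (cA = t → P ∈ Set.Icc 0 (2 * (1 - cA) / (2 - cA) * (MA / cA))) ∧
       (t < cA → P = 0)) ∧
      RA = MA - cA * P) ∧
    -- the optimal payoff
    (∀ P RA v : ℝ, GeneralLotto.IsOptimalInvestment w τ MA cA RB P RA v →
      (cA < t → v = 1 - RB / (2 * MA) * cA * (2 - cA)) ∧
      (t ≤ cA → 1 ≤ MA / RB → v = 1 - RB / (2 * MA)) ∧
      (t ≤ cA → MA / RB < 1 → v = MA / (2 * RB))) := by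
  refine ⟨fun P RA hP hRA => ⟨fun v v' h h' => h.unique h', fun h => ?_⟩, ?_⟩
  · rcases hRA.lt_or_eq with hpos | rfl
    · obtain ⟨μ, -, -, -, hS⟩ := GeneralLotto.exists_contest_of_pos hw hw1 hτ hP hpos hRB
      exact ⟨_, hS⟩
    · exact GeneralLotto.exists_isSPEPayoff_of_ties_zero hw hw1
        (h.resolve_left (lt_irrefl _)) hP hRB.le
  set Q := 2 * (1 - cA) / (2 - cA) * (MA / cA) with hQ
  rcases lt_or_ge t cA with htc | hct
  · set m := min 1 (RB / MA) with hm
    -- Both sides are `min MA RB`, so `t < cA` is the strict price condition of the expensive case.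
    have hmt : m * MA = t * RB := by
      rw [hm, ht, min_mul_of_nonneg _ _ hMA.le, min_mul_of_nonneg _ _ hRB.le,
        div_mul_cancel₀ _ hMA.ne', div_mul_cancel₀ _ hRB.ne', one_mul, one_mul, min_comm]
    have key := GeneralLotto.isOptimalInvestment_iff_of_expensive hw hw1 hτ hMA hRB hm
      (c := cA) (hmt ▸ mul_lt_mul_of_pos_right htc hRB)
    constructor
    · intro P RA
      simp only [key, exists_and_left, exists_eq, and_true]
      constructor
      · rintro ⟨rfl, rfl⟩
        exact ⟨⟨fun h => absurd h htc.not_gt, fun h => absurd h htc.ne', fun _ => rfl⟩, by simp⟩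
      · rintro ⟨⟨-, -, h⟩, rfl⟩
        rw [h htc]
        simp
    · intro P RA v hv
      obtain ⟨-, rfl⟩ := (key P RA v).1 hv
      refine ⟨fun h => absurd h htc.not_gt, fun _ h => ?_, fun _ h => ?_⟩
      · rw [one_le_div hRB] at h
        rw [hm, min_eq_right ((div_le_one hMA).2 h)]
        field_simp
        ring
      · rw [div_lt_one hRB] at h
        rw [hm, min_eq_left ((one_le_div hMA).2 h.le)]
        ring
  · have hc1 : cA ≤ 1 := hct.trans (ht ▸ min_le_left _ _)
    have hcM : cA ≤ MA / RB := hct.trans (ht ▸ min_le_right _ _)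
    have hcRB : cA * RB ≤ MA := (le_div_iff₀ hRB).1 hcM
    set m := cA * RB / MA with hm
    have hmM : m * MA = cA * RB := div_mul_cancel₀ _ hMA.ne'
    have key := GeneralLotto.isOptimalInvestment_iff_of_cheap hw hw1 hτ hMA hcA hc1 hRB hmM
      ((div_le_one hMA).2 hcRB) hQ
    have hval : 1 - m + MA * m ^ 2 / (2 * RB) = 1 - RB / (2 * MA) * cA * (2 - cA) := by
      rw [hm]
      field_simp
      ring
    have hQ0 : 0 ≤ Q := by
      have h1 : 0 ≤ 1 - cA := by linarith
      have h2 : 0 < 2 - cA := by linarith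
      positivity
    constructor
    · intro P RA
      simp only [key, exists_and_left, exists_eq, and_true]
      refine and_congr_left' ⟨?_, ?_⟩
      · rintro ⟨hP, hPQ, h⟩
        refine ⟨fun hlt => h ?_, fun _ => ⟨hP, hPQ⟩, fun h' => absurd h' hct.not_gt⟩
        rw [hm, div_lt_one hMA, ← lt_div_iff₀ hRB]
        exact hlt.trans_le (ht ▸ min_le_right _ _)
      · rintro ⟨h1, h2, -⟩
        rcases hct.lt_or_eq with hlt | heq
        · rw [h1 hlt]
          exact ⟨hQ0, le_rfl, fun _ => rfl⟩
        · obtain ⟨hP, hPQ⟩ := h2 heq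
          refine ⟨hP, hPQ, fun hlt => ?_⟩
          rw [hm, div_lt_one hMA, ← lt_div_iff₀ hRB] at hlt
          -- At `cA = t`, `m < 1` rules out `t = MA / RB`; hence `t = 1`, and the interval shrinks
          -- to `{0}`.
          have hc : cA = 1 := by
            rcases min_choice 1 (MA / RB) with h | h
            · rw [heq, ht, h]
            · rw [heq, ht, h] at hlt
              exact absurd hlt (lt_irrefl _)
          have : Q = 0 := by rw [hQ, hc]; norm_num
          linarith
    · intro P RA v hv
      obtain ⟨-, rfl⟩ := (key P RA v).1 hv
      rw [hval]
      refine ⟨fun _ => rfl, fun h h1 => ?_, fun h h1 => ?_⟩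
      · have hc : cA = 1 := by rw [le_antisymm hct h, ht, min_eq_left h1]
        rw [hc]
        ring
      · have hc : cA = MA / RB := by rw [le_antisymm hct h, ht, min_eq_right h1.le]
        rw [hc]
        field_simp
        ring
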